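/- Let $\mathcal L$ denote Lebesgue measure on $\mathbb R^d$, $d\ge 1$, and let $S\subset\mathbb R^d$ be a Borel set with $0<\mathcal L(S)<\infty$. Let $\mathbb M(S)$ be the set of (finite) simple point measures on $S$, i.e. finite sums of unit point masses at distinct points of $S$, with the $\sigma$-algebra generated by the maps $\nu\mapsto\nu(B)$, $B\subset S$ Borel. For $\lambda>\mu>0$, a (deterministic, Poisson) thinning on $S$ from $\lambda$ to $\mu$ is a measurable function $f:\mathbb M(S)\to\mathbb M(S)$ such that, if $\Pi$ is a homogeneous Poisson process of intensity $\lambda$ on $S$, then $f(\Pi)$ is a homogeneous Poisson process of intensity $\mu$ on $S$, and almost surely every point of $f(\Pi)$ is a point of $\Pi$. Corollary (Non-monotonicity in $\mu$). (a) For every $d\ge1$ and every such $S$ there exist real numbers $\lambda>\mu>\mu'>0$ such that there is a thinning on $S$ from $\lambda$ to $\mu$, but there is no thinning on $S$ from $\lambda$ to $\mu'$. (b) If $\mathcal L(S)=1$, in particular if $S=[0,1]\subset\mathbb R$, then $(\lambda,\mu,\mu')=(1.45,\,0.7,\,0.6)$ is such an example. -/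

import Mathlib

open MeasureTheory ProbabilityTheory
open scoped NNReal ENNReal

/-- A (finite) simple point measure on `α`: a finite sum of unit point masses at distinct points.
It carries the σ-algebra generated by the counting maps `ν ↦ ν B`, `B` measurable (inherited from
the σ-algebra of `Measure α`). -/
abbrev SimplePointMeasure (α : Type*) [MeasurableSpace α] : Type _ :=
  {ν : Measure α // ∃ s : Finset α, ν = ∑ x ∈ s, Measure.dirac x}

/-- The set of points (atoms) of a simple point measure. -/
def SimplePointMeasure.points {α : Type*} [MeasurableSpace α] (ν : SimplePointMeasure α) : Set α :=
  {x | ν.1 {x} = 1}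

/-- The random simple point measure `N`, defined on the probability space `(Ω, P)`, is a Poisson
point process on `α` with (finite) mean measure `m`: the number of points in a measurable set `B`
is Poisson with mean `m B`, and the numbers of points in disjoint sets are independent. -/
structure IsPoissonProcess {Ω α : Type*} [MeasurableSpace Ω] [MeasurableSpace α]
    (m : Measure α) (N : Ω → SimplePointMeasure α) (P : Measure Ω) : Prop where
  measurable : Measurable N
  count_law : ∀ B : Set α, MeasurableSet B →
    HasLaw (fun ω => (N ω).1 B)
      ((poissonMeasure (m B).toNNReal).map (fun n : ℕ => (n : ℝ≥0∞))) P
  count_indep : ∀ (n : ℕ) (B : Fin n → Set α), (∀ i, MeasurableSet (B i)) →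
    Pairwise (fun i j => Disjoint (B i) (B j)) →
    iIndepFun (fun i ω => (N ω).1 (B i)) P

/-- `f` is a (deterministic, Poisson) thinning on `S` from `r` to `s`: a measurable map such that,
for a homogeneous Poisson process of intensity `r` on `S`, the image process is homogeneous
Poisson of intensity `s` on `S`, and almost surely every point of the image is a point of the
original process. The process is taken on its canonical space (`P` is its law, `id` the process);
the law is determined by `S` and `r`, so the choice of `P` is immaterial. -/
def IsThinning {E : Type*} [MeasureSpace E] (S : Set E) (r s : ℝ≥0)
    (f : SimplePointMeasure S → SimplePointMeasure S) : Prop :=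
  Measurable f ∧
    ∃ P : Measure (SimplePointMeasure S), IsProbabilityMeasure P ∧
      IsPoissonProcess (r • volume.comap (Subtype.val : S → E)) id P ∧
      IsPoissonProcess (s • volume.comap (Subtype.val : S → E)) f P ∧
      ∀ᵐ ν ∂P, (f ν).points ⊆ ν.points

/-- There is a thinning on `S` from `r` to `s`. -/
def ThinningExists {E : Type*} [MeasureSpace E] (S : Set E) (r s : ℝ≥0) : Prop :=
  ∃ f : SimplePointMeasure S → SimplePointMeasure S, IsThinning S r s f

/-! After normalising the mean measure to `c • ρ` with `ρ` an atomless probability measure, the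
matter is decided by configurations with at most one point.

Impossibility (`not_isPoissonProcess_thinning`): a deterministic map has no randomness to use on a
lone point beyond its location. If lone points in `A` are kept, comparing the events "exactly one
point, lying in `A`" gives `r e^{-r} ρ(A) ≤ s e^{-s} ρ(A)`. When `s e^{-s} < r e^{-r}`, `A` is null,
so almost every configuration with at most one point is emptied and `(1 + r) e^{-r} ≤ e^{-s}`. This
fails for `r = 1.45`, `s = 0.6`.

Existence: for `s = 0.7` the Poisson numbers of points can be coupled so that `0` and `1` are fixed
and every `n ≥ 2` strictly decreases (`exists_coupling`). Such a coupling is realized without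
external randomness (`exists_thinning_of_coupling`). Two independent uniform labels, on the circle
and on `[0, 1]`, are read off the location of each point. The circle labels of all points are added,
and the sum decides which points, ranked by the second label, survive. Given all but one of the
points and the second label of the missing one, the sum is still uniform (`integral_selection`).
Since some point is always lost when the choice is not trivial, the survivors are independent with
law `ρ` given their number. Characteristic functions of counts turn this into the Poisson property.
-/

instance SimplePointMeasure.instIsFiniteMeasure {α : Type*} [MeasurableSpace α]
    (ν : SimplePointMeasure α) : IsFiniteMeasure ν.1 := by
  obtain ⟨s, hs⟩ := ν.2
  rw [hs]
  infer_instance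

lemma SimplePointMeasure.measurable_apply {α : Type*} [MeasurableSpace α] {B : Set α}
    (hB : MeasurableSet B) : Measurable fun ν : SimplePointMeasure α => ν.1 B :=
  (Measure.measurable_coe hB).comp measurable_subtype_coe

/-! ### Recognising a Poisson process by the joint characteristic function of its counts -/

open Complex in
theorem IsPoissonProcess.of_charFun {Ω α : Type*} [MeasurableSpace Ω] [MeasurableSpace α]
    {P : Measure Ω} [IsProbabilityMeasure P] {N : Ω → SimplePointMeasure α} (hN : Measurable N)
    (m : Measure α)
    (h : ∀ (n : ℕ) (B : Fin n → Set α), (∀ i, MeasurableSet (B i)) →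
      Pairwise (fun i j => Disjoint (B i) (B j)) → ∀ t : Fin n → ℝ,
      ∫ ω, cexp ((∑ j, ((N ω).1 (B j)).toReal * t j : ℝ) * I) ∂P =
        ∏ j, cexp ((m (B j)).toReal * (cexp (t j * I) - 1))) :
    IsPoissonProcess m N P := by
  have hmeas : ∀ B : Set α, MeasurableSet B → Measurable fun ω => (N ω).1 B := fun B hB =>
    (SimplePointMeasure.measurable_apply hB).comp hN
  have hrec : ∀ B : Set α, (fun ω => (N ω).1 B) =
      ENNReal.ofReal ∘ fun ω => ((N ω).1 B).toReal := fun B => by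
    ext ω
    simp
  -- The one-set case gives the marginals; the product form for several disjoint sets then gives
  -- independence.
  have hchar : ∀ B : Set α, MeasurableSet B → ∀ t : ℝ,
      charFun (P.map fun ω => ((N ω).1 B).toReal) t =
        cexp ((m B).toReal * (cexp (t * I) - 1)) := fun B hB t => by
    have h1 := h 1 (fun _ => B) (fun _ => hB) (fun i j hij => absurd (Subsingleton.elim i j) hij)
      (fun _ => t)
    rw [charFun_apply, integral_map (hmeas B hB).ennreal_toReal.aemeasurable (by fun_prop)]
    simpa [mul_comm t] using h1
  refine ⟨hN, fun B hB => ⟨(hmeas B hB).aemeasurable, ?_⟩, fun n B hB hd => ?_⟩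
  · have : P.map (fun ω => ((N ω).1 B).toReal) =
        (poissonMeasure (m B).toNNReal).map (Nat.cast : ℕ → ℝ) := by
      have : IsProbabilityMeasure (P.map (fun ω => ((N ω).1 B).toReal)) :=
        Measure.isProbabilityMeasure_map (hmeas B hB).ennreal_toReal.aemeasurable
      refine Measure.ext_of_charFun (funext fun t => ?_)
      rw [hchar B hB, charFun_map_cast_poissonMeasure]
      rfl
    rw [hrec B, ← Measure.map_map ENNReal.measurable_ofReal (hmeas B hB).ennreal_toReal, this,
      Measure.map_map ENNReal.measurable_ofReal .of_discrete]
    congr 1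
    ext k
    simp
  · have key : iIndepFun (fun i ω => ((N ω).1 (B i)).toReal) P := by
      rw [iIndepFun_iff_charFun_pi fun i => (hmeas _ (hB i)).ennreal_toReal.aemeasurable]
      intro t
      rw [charFun_apply, integral_map, Finset.prod_congr rfl fun i _ => hchar _ (hB i) (t i),
        ← h n B hB hd (fun i => t i)]
      · congr 1
        ext ω
        simp [PiLp.inner_apply, mul_comm]
      · have := fun i => (hmeas _ (hB i)).ennreal_toReal
        exact ((WithLp.measurable_toLp 2 _).comp (measurable_pi_lambda _ this)).aemeasurable
      · fun_prop
    have := key.comp (fun _ => ENNReal.ofReal) fun _ => ENNReal.measurable_ofReal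
    convert this using 2 with i
    exact hrec (B i)

/-! ### The obstruction from one-point configurations -/

lemma sum_dirac_apply {α : Type*} [MeasurableSpace α] (s : Finset α) {B : Set α}
    [DecidablePred (· ∈ B)] (hB : MeasurableSet B) :
    (∑ x ∈ s, Measure.dirac x : Measure α) B = ((s.filter (· ∈ B)).card : ℝ≥0∞) := by
  simp [Measure.finsetSum_apply, Measure.dirac_apply' _ hB, Set.indicator_apply]

lemma SimplePointMeasure.points_eq {α : Type*} [MeasurableSpace α] [MeasurableSingletonClass α]
    (ν : SimplePointMeasure α) {s : Finset α} (hs : ν.1 = ∑ x ∈ s, Measure.dirac x) :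
    ν.points = s := by
  classical
  ext x
  rw [points, Set.mem_ofPred_eq, hs, sum_dirac_apply s (measurableSet_singleton x)]
  by_cases hx : x ∈ s
  · have : s.filter (· ∈ ({x} : Set α)) = {x} := by ext y; simp; rintro rfl; exact hx
    rw [this]
    simp [hx]
  · have : s.filter (· ∈ ({x} : Set α)) = ∅ := by ext y; simp; rintro h rfl; exact hx h
    rw [this]
    simp [hx]

lemma IsPoissonProcess.measure_eq_natCast {Ω α : Type*} [MeasurableSpace Ω] [MeasurableSpace α]
    {m : Measure α} {N : Ω → SimplePointMeasure α} {P : Measure Ω} (h : IsPoissonProcess m N P)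
    {B : Set α} (hB : MeasurableSet B) (k : ℕ) :
    P {ω | (N ω).1 B = k} =
      ENNReal.ofReal (Real.exp (-(m B).toReal) * (m B).toReal ^ k / k.factorial) := by
  have hk : MeasurableSet {x : ℝ≥0∞ | x = k} := measurableSet_singleton _
  rw [(h.count_law B hB).measure_eq hk, Measure.map_apply .of_discrete hk]
  have : (fun n : ℕ => (n : ℝ≥0∞)) ⁻¹' {x | x = k} = {k} := by ext; simp
  rw [this, poissonMeasure_singleton]
  rfl

lemma IsPoissonProcess.measure_inter_compl {Ω α : Type*} [MeasurableSpace Ω] [MeasurableSpace α]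
    {m : Measure α} {N : Ω → SimplePointMeasure α} {P : Measure Ω} (h : IsPoissonProcess m N P)
    {B : Set α} (hB : MeasurableSet B) (j k : ℕ) :
    P {ω | (N ω).1 B = j ∧ (N ω).1 Bᶜ = k} =
      P {ω | (N ω).1 B = j} * P {ω | (N ω).1 Bᶜ = k} := by
  have hi := h.count_indep 2 ![B, Bᶜ] (by simp [Fin.forall_fin_two, hB]) (by
    intro i j hij
    fin_cases i <;> fin_cases j <;> first
      | exact absurd rfl hij
      | exact disjoint_compl_right
      | exact disjoint_compl_left)
  exact (hi.indepFun (i := 0) (j := 1) (by decide)).measure_inter_preimage_eq_mul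
    {(j : ℝ≥0∞)} {(k : ℝ≥0∞)} (measurableSet_singleton _) (measurableSet_singleton _)

/-- The only way to thin a configuration with at most one point from intensity `r` to intensity
`s` is to delete it, as soon as one-point configurations are less likely for the latter. -/
theorem not_isPoissonProcess_thinning {α : Type*} [MeasurableSpace α] [MeasurableSingletonClass α]
    {ρ : Measure α} [IsProbabilityMeasure ρ] {r s : ℝ≥0}
    {f : SimplePointMeasure α → SimplePointMeasure α} {P : Measure (SimplePointMeasure α)}
    (h₁ : (s : ℝ) * Real.exp (-s) < r * Real.exp (-r))
    (h₂ : Real.exp (-s) < (1 + r) * Real.exp (-r))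
    (hr : IsPoissonProcess (r • ρ) (fun ν => ν) P) (hs : IsPoissonProcess (s • ρ) f P)
    (hsub : ∀ᵐ ν ∂P, (f ν).points ⊆ ν.points) : False := by
  classical
  have hdirac : Measurable fun x : α => (⟨Measure.dirac x, {x}, by simp⟩ : SimplePointMeasure α) :=
    Measurable.subtype_mk Measure.measurable_dirac
  -- The locations at which a lone point survives.
  set A : Set α := {x | (f ⟨Measure.dirac x, {x}, by simp⟩).1 Set.univ = 1} with hA
  have hAm : MeasurableSet A :=
    ((SimplePointMeasure.measurable_apply MeasurableSet.univ).comp (hs.measurable.comp hdirac))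
      (measurableSet_singleton 1)
  have one_point : ∀ ν : SimplePointMeasure α, (f ν).points ⊆ ν.points →
      ∀ B : Set α, MeasurableSet B → ν.1 B = 1 → ν.1 Bᶜ = 0 →
      ∃ x ∈ B, ν = ⟨Measure.dirac x, {x}, by simp⟩ ∧
        ((f ν).1 = Measure.dirac x ∨ (f ν).1 = 0) := by
    intro ν hν B hB h1 h0
    obtain ⟨t, ht⟩ := ν.2
    obtain ⟨u, hu⟩ := (f ν).2
    rw [ν.points_eq ht, (f ν).points_eq hu, Finset.coe_subset] at hν
    rw [ht, sum_dirac_apply _ hB, Nat.cast_eq_one] at h1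
    rw [ht, sum_dirac_apply _ hB.compl, Nat.cast_eq_zero, Finset.card_eq_zero] at h0
    obtain ⟨x, hx⟩ := Finset.card_eq_one.1 h1
    have htx : t = {x} := by
      rw [← hx]
      refine (Finset.filter_true_of_mem fun y hy => ?_).symm
      by_contra hyB
      have := Finset.eq_empty_iff_forall_notMem.1 h0 y
      simp [hy, hyB] at this
    have hxB : x ∈ B := by
      have : x ∈ t.filter (· ∈ B) := by simp [hx]
      exact (Finset.mem_filter.1 this).2
    refine ⟨x, hxB, Subtype.ext (by simp [ht, htx]), ?_⟩
    rw [htx] at hν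
    rcases Finset.subset_singleton_iff.1 hν with h | h
    · right; simp [hu, h]
    · left; simp [hu, h]
  have hkeep : P {ν | ν.1 A = (1 : ℕ) ∧ ν.1 Aᶜ = (0 : ℕ)} ≤
      P {ν | (f ν).1 A = (1 : ℕ) ∧ (f ν).1 Aᶜ = (0 : ℕ)} := by
    refine measure_mono_ae ?_
    filter_upwards [hsub] with ν hν
    rintro ⟨h1, h0⟩
    obtain ⟨x, hxA, hx, hf⟩ := one_point ν hν A hAm (by simpa using h1) (by simpa using h0)
    have hf1 : (f ν).1 Set.univ = 1 := by rw [hx]; exact hxA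
    rcases hf with hf | hf
    · change (f ν).1 A = (1 : ℕ) ∧ (f ν).1 Aᶜ = (0 : ℕ)
      rw [hf, Measure.dirac_apply' _ hAm, Measure.dirac_apply' _ hAm.compl]
      simp [hxA]
    · rw [hf] at hf1
      simp at hf1
  have hmass : ∀ (c : ℝ≥0) (B : Set α), ((c • ρ) B).toReal = c * ρ.real B := fun c B => by
    simp [Measure.smul_apply, measureReal_def]
  have hcompl : ρ.real Aᶜ = 1 - ρ.real A := probReal_compl_eq_one_sub hAm
  rw [hr.measure_inter_compl hAm 1 0, hs.measure_inter_compl hAm,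
    hr.measure_eq_natCast hAm, hr.measure_eq_natCast hAm.compl,
    hs.measure_eq_natCast hAm, hs.measure_eq_natCast hAm.compl,
    ← ENNReal.ofReal_mul (by positivity), ← ENNReal.ofReal_mul (by positivity),
    ENNReal.ofReal_le_ofReal_iff (by positivity)] at hkeep
  simp only [hmass, hcompl, pow_one, pow_zero, Nat.factorial, Nat.cast_one, div_one, mul_one] at hkeep
  -- The probability of a single point, lying in `A`, is linear in `ρ(A)`, so `h₁` leaves only `ρ(A)
  -- = 0`.
  have hexp : ∀ c : ℝ, Real.exp (-(c * ρ.real A)) * (c * ρ.real A) *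
      Real.exp (-(c * (1 - ρ.real A))) = c * Real.exp (-c) * ρ.real A := fun c => by
    have : Real.exp (-c) = Real.exp (-(c * ρ.real A)) * Real.exp (-(c * (1 - ρ.real A))) := by
      rw [← Real.exp_add]; congr 1; ring
    rw [this]; ring
  rw [hexp, hexp] at hkeep
  have hA0 : ρ.real A = 0 := by
    have := measureReal_nonneg (μ := ρ) (s := A)
    nlinarith
  -- As `A` is null, this event has the probability `(1 + r) e^{-r}` of at most one point.
  have hdel : P ({ν | ν.1 A = (0 : ℕ) ∧ ν.1 Aᶜ = (0 : ℕ)} ∪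
      {ν | ν.1 A = (0 : ℕ) ∧ ν.1 Aᶜ = (1 : ℕ)}) ≤ P {ν | (f ν).1 Set.univ = (0 : ℕ)} := by
    refine measure_mono_ae ?_
    filter_upwards [hsub] with ν hν
    rintro (⟨h0, h1⟩ | ⟨h0, h1⟩)
    · obtain ⟨t, ht⟩ := ν.2
      obtain ⟨u, hu⟩ := (f ν).2
      rw [ν.points_eq ht, (f ν).points_eq hu, Finset.coe_subset] at hν
      have h : ν.1 = 0 := by
        rw [← Measure.measure_univ_eq_zero, ← measure_add_measure_compl hAm, h0, h1]
        simp
      have ht0 : t = ∅ := by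
        have : (t : Set α) = ∅ := by
          rw [← ν.points_eq ht, SimplePointMeasure.points, h]
          simp
        simpa using this
      change (f ν).1 Set.univ = (0 : ℕ)
      rw [ht0] at hν
      simp [hu, Finset.subset_empty.1 hν]
    · obtain ⟨x, hxA, hx, hf⟩ := one_point ν hν Aᶜ hAm.compl (by simpa using h1)
        (by simpa using h0)
      change (f ν).1 Set.univ = (0 : ℕ)
      rcases hf with hf | hf
      · exfalso
        refine hxA ?_
        rw [hA, Set.mem_ofPred_eq, ← hx, hf]
        simp
      · simp [hf]
  rw [measure_union] at hdel
  · rw [hr.measure_inter_compl hAm 0 0, hr.measure_inter_compl hAm 0 1,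
      hr.measure_eq_natCast hAm, hr.measure_eq_natCast hAm.compl,
      hr.measure_eq_natCast hAm.compl, hs.measure_eq_natCast MeasurableSet.univ,
      ← ENNReal.ofReal_mul (by positivity), ← ENNReal.ofReal_mul (by positivity),
      ← ENNReal.ofReal_add (by positivity) (by positivity),
      ENNReal.ofReal_le_ofReal_iff (by positivity)] at hdel
    simp only [hmass, hcompl, hA0] at hdel
    simp at hdel
    linarith
  · rw [Set.disjoint_left]
    rintro ν ⟨-, h0⟩ ⟨-, h1⟩
    rw [h0] at h1
    simp at h1
  · exact ((SimplePointMeasure.measurable_apply hAm) (measurableSet_singleton _)).inter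
      ((SimplePointMeasure.measurable_apply hAm.compl) (measurableSet_singleton _))

/-! ### Atomless measures as a source of uniform randomness -/

open Filter Topology in
lemma continuous_cdf {μ : Measure ℝ} [IsProbabilityMeasure μ] [NullSingletonClass μ] :
    Continuous (cdf μ) := by
  refine continuous_iff_continuousAt.2 fun x => ?_
  rw [(monotone_cdf μ).continuousAt_iff_leftLim_eq_rightLim, StieltjesFunction.rightLim_eq]
  have h := (cdf μ).measure_singleton x
  rw [measure_cdf, measure_singleton, eq_comm, ENNReal.ofReal_eq_zero] at h
  exact le_antisymm ((monotone_cdf μ).leftLim_le le_rfl) (by linarith)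

open Filter Topology in
/-- The distribution function transform of an atomless probability measure is uniform. -/
lemma map_cdf_eq_volume {μ : Measure ℝ} [IsProbabilityMeasure μ] [NullSingletonClass μ] :
    μ.map (fun x => (⟨cdf μ x, cdf_nonneg μ x, cdf_le_one μ x⟩ : unitInterval)) = volume := by
  have hm : Measurable fun x => (⟨cdf μ x, cdf_nonneg μ x, cdf_le_one μ x⟩ : unitInterval) :=
    continuous_cdf.measurable.subtype_mk
  have := Measure.isProbabilityMeasure_map (μ := μ) hm.aemeasurable
  refine Measure.ext_of_Iic _ _ fun t => ?_
  rw [Measure.map_apply hm measurableSet_Iic, unitInterval.volume_Iic]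
  -- At `t = 1` the sublevel set is the whole line, so its supremum below would be a junk value.
  by_cases ht1 : (t : ℝ) = 1
  · have : ((fun x => (⟨cdf μ x, cdf_nonneg μ x, cdf_le_one μ x⟩ : unitInterval)) ⁻¹' Set.Iic t) =
        Set.univ := by
      ext x
      simp only [Set.mem_preimage, Set.mem_Iic, Set.mem_univ, iff_true, ← Subtype.coe_le_coe, ht1]
      exact cdf_le_one μ x
    simp [this, ht1]
  have ht1' : (t : ℝ) < 1 := lt_of_le_of_ne t.2.2 ht1
  have hbdd : ∃ b, ∀ x, cdf μ x ≤ t → x ≤ b := by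
    obtain ⟨b, hb⟩ := ((tendsto_cdf_atTop μ).eventually (lt_mem_nhds ht1')).exists
    exact ⟨b, fun x hx => le_of_lt ((monotone_cdf μ).reflect_lt (hx.trans_lt hb))⟩
  by_cases hne : ∃ x, cdf μ x ≤ t
  · obtain ⟨b, hb⟩ := hbdd
    obtain ⟨x₀, hx₀⟩ := hne
    set c := sSup {x | cdf μ x ≤ t} with hc
    have hbd : BddAbove {x | cdf μ x ≤ t} := ⟨b, fun x hx => hb x hx⟩
    have hcmem : cdf μ c ≤ t :=
      (isClosed_le continuous_cdf continuous_const).csSup_mem ⟨x₀, hx₀⟩ hbd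
    have hset : ((fun x => (⟨cdf μ x, cdf_nonneg μ x, cdf_le_one μ x⟩ : unitInterval)) ⁻¹'
        Set.Iic t) = Set.Iic c := by
      ext x
      simp only [Set.mem_preimage, Set.mem_Iic, ← Subtype.coe_le_coe]
      exact ⟨fun hx => le_csSup hbd hx, fun hx => (monotone_cdf μ hx).trans hcmem⟩
    have hct : cdf μ c = t := by
      refine le_antisymm hcmem (ge_of_tendsto
        (continuous_cdf.continuousAt.tendsto.mono_left nhdsWithin_le_nhds : Tendsto (cdf μ) (𝓝[>] c) _)
        (eventually_nhdsWithin_of_forall fun y hy => ?_))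
      by_contra! h
      exact absurd (le_csSup hbd h.le) (not_le.2 hy)
    rw [hset, ← ofReal_cdf, hct]
  · push Not at hne
    have hset : ((fun x => (⟨cdf μ x, cdf_nonneg μ x, cdf_le_one μ x⟩ : unitInterval)) ⁻¹'
        Set.Iic t) = ∅ := by
      ext x
      simpa [← Subtype.coe_le_coe] using hne x
    have ht0 : (t : ℝ) ≤ 0 := ge_of_tendsto (tendsto_cdf_atBot μ) (.of_forall fun x => (hne x).le)
    rw [hset, measure_empty, ENNReal.ofReal_of_nonpos ht0]

/-- Every probability measure on a standard Borel space is an image of any given atomless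
probability measure on a standard Borel space. -/
theorem exists_measurable_map_eq_of_noAtoms {α β : Type*} [MeasurableSpace α]
    [StandardBorelSpace α] [MeasurableSpace β] [StandardBorelSpace β] (ρ : Measure α)
    [IsProbabilityMeasure ρ] [NullSingletonClass ρ] (κ : Measure β) [IsProbabilityMeasure κ] :
    ∃ g : α → β, Measurable g ∧ ρ.map g = κ := by
  have : Nonempty β := κ.nonempty_of_neZero
  obtain ⟨g, hg, hgκ⟩ := κ.exists_measurable_map_eq
  have he := measurableEmbedding_embeddingReal α
  have hP : IsProbabilityMeasure (ρ.map (embeddingReal α)) :=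
    Measure.isProbabilityMeasure_map he.measurable.aemeasurable
  have hNA : NullSingletonClass (ρ.map (embeddingReal α)) := ⟨fun x => by
    rw [he.map_apply]
    exact (Set.subsingleton_singleton.preimage he.injective).measure_zero ρ⟩
  have hm : Measurable fun x => (⟨cdf (ρ.map (embeddingReal α)) x, cdf_nonneg _ x,
      cdf_le_one _ x⟩ : unitInterval) := continuous_cdf.measurable.subtype_mk
  refine ⟨_, hg.comp (hm.comp he.measurable), ?_⟩
  rw [← Measure.map_map hg (hm.comp he.measurable), ← Measure.map_map hm he.measurable,
    map_cdf_eq_volume, hgκ]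

/-! ### Measurable construction of the thinning and of configurations from tuples -/

namespace SimplePointMeasure

variable {α : Type*} [MeasurableSpace α]

/-- Needed because the sets measured by `ν` here, such as the points of smaller rank, themselves
vary with the parameter. -/
lemma measurable_apply_prodMk {β : Type*} [MeasurableSpace β] {g : β → SimplePointMeasure α}
    (hg : Measurable g) {t : Set (β × α)} (ht : MeasurableSet t) :
    Measurable fun b => (g b).1 (Prod.mk b ⁻¹' t) :=
  Kernel.measurable_kernel_prodMk_left_of_finite
    (κ := ⟨fun b => (g b).1, measurable_subtype_coe.comp hg⟩) ht
    fun b => (g b).instIsFiniteMeasure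

/-- The representative in `[0, 1)` of a point of the circle. -/
noncomputable def circleLift (a : UnitAddCircle) : ℝ := AddCircle.measurableEquivIco 1 0 a

lemma measurable_circleLift : Measurable circleLift :=
  measurable_subtype_coe.comp (AddCircle.measurableEquivIco (1 : ℝ) 0).measurable

lemma circleLift_nonneg (a : UnitAddCircle) : 0 ≤ circleLift a :=
  (AddCircle.measurableEquivIco (1 : ℝ) 0 a).2.1

lemma coe_circleLift (a : UnitAddCircle) : (circleLift a : UnitAddCircle) = a :=
  (AddCircle.equivIco (1 : ℝ) 0).left_inv a

/-- The sum, in the circle, of the labels `A x` of the points `x` of `ν`. -/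
noncomputable def labelSum (A : α → UnitAddCircle) (ν : SimplePointMeasure α) : UnitAddCircle :=
  ((∫⁻ x, ENNReal.ofReal (circleLift (A x)) ∂ν.1).toReal : ℝ)

lemma measurable_labelSum {A : α → UnitAddCircle} (hA : Measurable A) :
    Measurable (labelSum A) :=
  AddCircle.measurable_mk'.comp (((Measure.measurable_lintegral
    (ENNReal.measurable_ofReal.comp (measurable_circleLift.comp hA))).comp
      measurable_subtype_coe).ennreal_toReal)

/-- The integral of nonnegative representatives makes the sum visibly measurable in `ν`; passing to
the quotient removes the choice of representatives. -/
lemma labelSum_eq {A : α → UnitAddCircle} (hA : Measurable A) {ι : Type*} [Fintype ι]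
    (ν : SimplePointMeasure α) (x : ι → α) (hν : ν.1 = ∑ i, Measure.dirac (x i)) :
    labelSum A ν = ∑ i, A (x i) := by
  have hm : Measurable fun x => ENNReal.ofReal (circleLift (A x)) :=
    ENNReal.measurable_ofReal.comp (measurable_circleLift.comp hA)
  rw [labelSum, hν, lintegral_finsetSum_measure]
  simp_rw [lintegral_dirac' _ hm]
  rw [ENNReal.toReal_sum (by simp)]
  simp_rw [ENNReal.toReal_ofReal (circleLift_nonneg _)]
  rw [← Finset.sum_congr rfl fun i _ => coe_circleLift (A (x i))]
  exact map_sum (QuotientAddGroup.mk' _) _ _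

/-- The points retained by the thinning: those whose rank, with respect to `V`, belongs to the set
`φ n s`, where `n` is the number of points and `s` the sum of the labels. -/
def retained (A : α → UnitAddCircle) (V : α → ℝ) (φ : ℕ → UnitAddCircle → Finset ℕ)
    (ν : SimplePointMeasure α) : Set α :=
  {x | ∃ n k : ℕ, ν.1 Set.univ = n ∧ k ∈ φ n (labelSum A ν) ∧ ν.1 {y | V y < V x} = k}

variable {A : α → UnitAddCircle} {V : α → ℝ} {φ : ℕ → UnitAddCircle → Finset ℕ}

lemma measurableSet_retained_prod (hA : Measurable A) (hV : Measurable V)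
    (hφ : ∀ n k, MeasurableSet {s | k ∈ φ n s}) :
    MeasurableSet {p : SimplePointMeasure α × α | p.2 ∈ retained A V φ p.1} := by
  have h : {p : SimplePointMeasure α × α | p.2 ∈ retained A V φ p.1} = ⋃ n : ℕ, ⋃ k : ℕ,
      ((fun p : SimplePointMeasure α × α => p.1.1 Set.univ) ⁻¹' {(n : ℝ≥0∞)} ∩
      ((fun p : SimplePointMeasure α × α => labelSum A p.1) ⁻¹' {s | k ∈ φ n s} ∩
      (fun p : SimplePointMeasure α × α => p.1.1 {y | V y < V p.2}) ⁻¹' {(k : ℝ≥0∞)})) := by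
    ext p
    simp [retained]
  rw [h]
  refine .iUnion fun n => .iUnion fun k => .inter ?_ (.inter ?_ ?_)
  · exact ((measurable_apply MeasurableSet.univ).comp measurable_fst) (measurableSet_singleton _)
  · exact ((measurable_labelSum hA).comp measurable_fst) (hφ n k)
  · exact measurable_apply_prodMk (t := {q : (SimplePointMeasure α × α) × α | V q.2 < V q.1.2})
      measurable_fst (measurableSet_lt (hV.comp measurable_snd)
        (hV.comp (measurable_snd.comp measurable_fst))) (measurableSet_singleton _)

lemma measurableSet_retained (hA : Measurable A) (hV : Measurable V)
    (hφ : ∀ n k, MeasurableSet {s | k ∈ φ n s}) (ν : SimplePointMeasure α) :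
    MeasurableSet (retained A V φ ν) :=
  measurable_prodMk_left (measurableSet_retained_prod hA hV hφ)

/-- The restriction of a simple point measure to a measurable set. -/
noncomputable def restrict (ν : SimplePointMeasure α) (C : Set α) (hC : MeasurableSet C) :
    SimplePointMeasure α :=
  ⟨ν.1.restrict C, by
    classical
    obtain ⟨s, hs⟩ := ν.2
    refine ⟨s.filter (· ∈ C), Measure.ext fun B hB => ?_⟩
    rw [Measure.restrict_apply hB, hs, sum_dirac_apply _ (hB.inter hC), sum_dirac_apply _ hB,
      Finset.filter_filter]
    simp only [Set.mem_inter_iff, and_comm]⟩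

/-- The thinning that retains the points of `retained A V φ ν`. -/
noncomputable def thin (hA : Measurable A) (hV : Measurable V)
    (hφ : ∀ n k, MeasurableSet {s | k ∈ φ n s}) (ν : SimplePointMeasure α) :
    SimplePointMeasure α :=
  ν.restrict (retained A V φ ν) (measurableSet_retained hA hV hφ ν)

lemma measurable_thin (hA : Measurable A) (hV : Measurable V)
    (hφ : ∀ n k, MeasurableSet {s | k ∈ φ n s}) : Measurable (thin hA hV hφ) := by
  refine Measurable.subtype_mk (Measure.measurable_of_measurable_coe _ fun B hB => ?_)
  simp_rw [Measure.restrict_apply hB]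
  exact measurable_apply_prodMk measurable_id
    (t := {p : SimplePointMeasure α × α | p.2 ∈ B ∩ retained A V φ p.1})
    ((measurable_snd hB).inter (measurableSet_retained_prod hA hV hφ))

lemma points_restrict_subset [MeasurableSingletonClass α] (ν : SimplePointMeasure α) (C : Set α)
    (hC : MeasurableSet C) : (ν.restrict C hC).points ⊆ ν.points := by
  intro x hx
  have h1 : ν.1.restrict C {x} = 1 := hx
  rw [Measure.restrict_apply (measurableSet_singleton x)] at h1
  by_cases hxC : x ∈ C
  · rwa [Set.inter_eq_left.2 (Set.singleton_subset_iff.2 hxC)] at h1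
  · rw [Set.singleton_inter_eq_empty.2 hxC] at h1
    simp at h1

open Classical in
/-- The simple point measure with atoms `x i`, or `0` if the `x i` are not distinct. -/
noncomputable def ofTuple {ι : Type*} [Fintype ι] (x : ι → α) : SimplePointMeasure α :=
  if hx : Function.Injective x then
    ⟨∑ i, Measure.dirac (x i), Finset.univ.map ⟨x, hx⟩, by simp⟩
  else ⟨0, ∅, by simp⟩

lemma coe_ofTuple {ι : Type*} [Fintype ι] {x : ι → α} (hx : Function.Injective x) :
    (ofTuple x).1 = ∑ i, Measure.dirac (x i) := by
  rw [ofTuple, dif_pos hx]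

lemma measurable_ofTuple [MeasurableEq α] {ι : Type*} [Fintype ι] :
    Measurable (ofTuple : (ι → α) → SimplePointMeasure α) := by
  classical
  have hinj : MeasurableSet {x : ι → α | Function.Injective x} := by
    have : {x : ι → α | Function.Injective x} = ⋂ i, ⋂ j, {x | x i = x j → i = j} := by
      ext x
      simp [Function.Injective]
    rw [this]
    refine .iInter fun i => .iInter fun j => ?_
    by_cases hij : i = j
    · simp [hij]
    · simp only [hij, imp_false]
      exact (measurableSet_eq_fun (measurable_pi_apply i) (measurable_pi_apply j)).compl
  have hsum : Measurable fun x : ι → α => ∑ i, Measure.dirac (x i) := by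
    refine Measure.measurable_of_measurable_coe _ fun B hB => ?_
    simp_rw [Measure.finsetSum_apply]
    exact Finset.measurable_fun_sum _ fun i _ => (Measure.measurable_coe hB).comp
      (Measure.measurable_dirac.comp (measurable_pi_apply i))
  have h : Measurable fun x : ι → α => (ofTuple x).1 := by
    have heq : (fun x : ι → α => (ofTuple x).1) =
        fun x => if Function.Injective x then ∑ i, Measure.dirac (x i) else 0 := by
      ext1 x
      by_cases hx : Function.Injective x <;> simp [ofTuple, hx]
    rw [heq]
    exact Measurable.ite hinj hsum measurable_const
  exact h.subtype_mk
end SimplePointMeasure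

/-! ### Ranks -/

/-- The number of entries of `u` that are smaller than `u i`. -/
noncomputable def tupleRank {n : ℕ} (u : Fin n → ℝ) (i : Fin n) : ℕ :=
  (Finset.univ.filter fun l => u l < u i).card

lemma tupleRank_lt_of_lt {n : ℕ} {u : Fin n → ℝ} {i j : Fin n} (h : u i < u j) :
    tupleRank u i < tupleRank u j := by
  refine Finset.card_lt_card (Finset.ssubset_iff_of_subset ?_ |>.2 ⟨i, by simpa using h, by simp⟩)
  exact fun l hl => by
    simp only [Finset.mem_filter, Finset.mem_univ, true_and] at hl ⊢
    exact hl.trans h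

lemma tupleRank_injective {n : ℕ} {u : Fin n → ℝ} (hu : Function.Injective u) :
    Function.Injective (tupleRank u) := by
  intro i j hij
  by_contra hne
  rcases lt_or_gt_of_ne (hu.ne hne) with h | h
  · exact (tupleRank_lt_of_lt h).ne hij
  · exact (tupleRank_lt_of_lt h).ne' hij

lemma tupleRank_lt {n : ℕ} (u : Fin n → ℝ) (i : Fin n) : tupleRank u i < n := by
  have : tupleRank u i < (Finset.univ : Finset (Fin n)).card :=
    Finset.card_lt_card (Finset.filter_ssubset.2 ⟨i, Finset.mem_univ i, lt_irrefl _⟩)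
  simpa using this

lemma measurable_tupleRank {n : ℕ} : Measurable (tupleRank : (Fin n → ℝ) → Fin n → ℕ) := by
  refine measurable_pi_lambda _ fun i => ?_
  simp_rw [tupleRank, Finset.card_filter]
  exact Finset.measurable_fun_sum _ fun l _ => Measurable.ite
    (measurableSet_lt (measurable_pi_apply l) (measurable_pi_apply i)) measurable_const
      measurable_const

lemma image_tupleRank_univ {n : ℕ} {u : Fin n → ℝ} (hu : Function.Injective u) :
    Finset.univ.image (tupleRank u) = Finset.range n := by
  refine Finset.eq_of_subset_of_card_le ?_ ?_
  · intro k hk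
    obtain ⟨i, -, rfl⟩ := Finset.mem_image.1 hk
    exact Finset.mem_range.2 (tupleRank_lt u i)
  · simp [Finset.card_image_of_injective _ (tupleRank_injective hu)]

/-- Ranks biject the indices with `range n`; this translates a choice of ranks into a choice of
indices. -/
lemma filter_tupleRank_mem_eq_iff {n : ℕ} {u : Fin n → ℝ} (hu : Function.Injective u)
    {T : Finset ℕ} (hT : T ⊆ Finset.range n) (K : Finset (Fin n)) :
    (Finset.univ.filter fun i => tupleRank u i ∈ T) = K ↔ T = K.image (tupleRank u) := by
  constructor
  · rintro rfl
    ext k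
    simp only [Finset.mem_image, Finset.mem_filter, Finset.mem_univ, true_and]
    constructor
    · intro hk
      have := hT hk
      rw [← image_tupleRank_univ hu] at this
      obtain ⟨i, -, rfl⟩ := Finset.mem_image.1 this
      exact ⟨i, hk, rfl⟩
    · rintro ⟨i, hi, rfl⟩
      exact hi
  · rintro rfl
    ext i
    simp [(tupleRank_injective hu).eq_iff]

lemma injective_insertNth {β : Type*} {m : ℕ} (j : Fin (m + 1)) {v : β} {z : Fin m → β}
    (hz : Function.Injective z) (hv : v ∉ Set.range z) :
    Function.Injective (j.insertNth v z : Fin (m + 1) → β) := by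
  have h : ∀ a b, (j.insertNth v z : Fin (m + 1) → β) a = (j.insertNth v z : Fin (m + 1) → β) b →
      a = b := by
    refine j.forall_iff_succAbove.2 ⟨j.forall_iff_succAbove.2 ⟨fun _ => rfl, fun l h => ?_⟩,
      fun k => j.forall_iff_succAbove.2 ⟨fun h => ?_, fun l h => ?_⟩⟩
    · simp only [Fin.insertNth_apply_same, Fin.insertNth_apply_succAbove] at h
      exact absurd ⟨l, h.symm⟩ hv
    · simp only [Fin.insertNth_apply_same, Fin.insertNth_apply_succAbove] at h
      exact absurd ⟨k, h⟩ hv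
    · simp only [Fin.insertNth_apply_succAbove] at h
      rw [hz h]
  exact fun a b => h a b

lemma measurableSet_eq_of_countable {β γ : Type*} [MeasurableSpace β] [Countable γ] {f g : β → γ}
    (hf : ∀ c, MeasurableSet {b | f b = c}) (hg : ∀ c, MeasurableSet {b | g b = c}) :
    MeasurableSet {b | f b = g b} := by
  have : {b | f b = g b} = ⋃ c, {b | f b = c} ∩ {b | g b = c} := by
    ext b
    simp [eq_comm]
  rw [this]
  exact .iUnion fun c => (hf c).inter (hg c)

lemma measurableSet_image_tupleRank {n : ℕ} (K : Finset (Fin n)) (T : Finset ℕ) :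
    MeasurableSet {u : Fin n → ℝ | K.image (tupleRank u) = T} :=
  measurable_tupleRank (t := {r : Fin n → ℕ | K.image r = T}) (Set.to_countable _).measurableSet

/-! ### Independence of the label sum from the surviving points -/

section AtomlessLabels

variable {α : Type*} [MeasurableSpace α] {ρ : Measure α} [IsProbabilityMeasure ρ] {V : α → ℝ}

lemma ae_injective_comp_pi (hV : Measurable V) (hV0 : ∀ c, ρ {x | V x = c} = 0) (n : ℕ) :
    ∀ᵐ x ∂Measure.pi fun _ : Fin n => ρ, Function.Injective (V ∘ x) := by
  have h : ∀ i j : Fin n, i ≠ j → ∀ᵐ x ∂Measure.pi fun _ : Fin n => ρ, V (x i) ≠ V (x j) := by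
    intro i j hij
    obtain _ | m := n
    · exact i.elim0
    obtain ⟨l, rfl⟩ := Fin.exists_succAbove_eq hij.symm
    have hm : MeasurableSet {p : α × (Fin m → α) | V p.1 = V (p.2 l)} :=
      measurableSet_eq_fun (hV.comp measurable_fst)
        (hV.comp ((measurable_pi_apply l).comp measurable_snd))
    have h0 : (ρ.prod (Measure.pi fun _ : Fin m => ρ))
        {p : α × (Fin m → α) | V p.1 = V (p.2 l)} = 0 := by
      rw [Measure.prod_apply_symm hm]
      simp [hV0]
    rw [← (measurePreserving_piFinSuccAbove (fun _ => ρ) i).measure_preimage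
      hm.nullMeasurableSet] at h0
    exact measure_eq_zero_iff_ae_notMem.1 h0
  have h' : ∀ᵐ x ∂Measure.pi fun _ : Fin n => ρ, ∀ i j : Fin n, i ≠ j → V (x i) ≠ V (x j) := by
    simp only [ae_all_iff]
    exact h
  filter_upwards [h'] with x hx i j hij
  by_contra hne
  exact hx i j hne hij

/-- The sum of the labels `A` is independent of all but one of the points together with all the
ranks, so a selection of ranks that depends on this sum does not bias the retained points. -/
lemma integral_selection {A : α → UnitAddCircle} (hA : Measurable A) (hV : Measurable V)
    {κ : Measure ℝ} [IsProbabilityMeasure κ] [NullSingletonClass κ]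
    (hAV : ρ.map (fun x => (A x, V x)) = (volume : Measure UnitAddCircle).prod κ)
    {m : ℕ} (j : Fin (m + 1)) (K : Finset (Fin (m + 1))) {H : (Fin m → α) → ℂ}
    (hH : Integrable H (Measure.pi fun _ => ρ)) {S : UnitAddCircle → Finset ℕ} (hS : ∀ T, MeasurableSet {s | S s = T})
    {c : ℝ} (hc : ∀ T ⊆ Finset.range (m + 1), T.card = K.card → volume.real {s | S s = T} = c) :
    ∫ x, {x : Fin (m + 1) → α | S (∑ i, A (x i)) = K.image (tupleRank (V ∘ x))}.indicator
      (fun x => H (j.removeNth x)) x ∂Measure.pi (fun _ => ρ) =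
      c * ∫ z, H z ∂Measure.pi (fun _ => ρ) := by
  have hVj : Measurable fun p : ℝ × (Fin m → α) =>
      (j.insertNth p.1 (V ∘ p.2) : Fin (m + 1) → ℝ) :=
    measurable_pi_iff.2 <| j.forall_iff_succAbove.2 ⟨by simpa using measurable_fst, fun l => by
      simpa [Function.comp_def] using hV.comp ((measurable_pi_apply l).comp measurable_snd)⟩
  -- The selection event, in terms of the two labels of point `j` and of the other points.
  set F : Set ((UnitAddCircle × ℝ) × (Fin m → α)) :=
    {p | S (p.1.1 + ∑ i, A (p.2 i)) =
      K.image (tupleRank (j.insertNth p.1.2 (V ∘ p.2) : Fin (m + 1) → ℝ))} with hF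
  have hFm : MeasurableSet F := by
    refine measurableSet_eq_of_countable (fun T => ?_) fun T => ?_
    · have : Measurable fun p : (UnitAddCircle × ℝ) × (Fin m → α) =>
          p.1.1 + ∑ i, A (p.2 i) :=
        (measurable_fst.comp measurable_fst).add (Finset.measurable_fun_sum _ fun i _ =>
          hA.comp ((measurable_pi_apply i).comp measurable_snd))
      exact this (hS T)
    · exact (hVj.comp ((measurable_snd.comp measurable_fst).prodMk measurable_snd))
        (measurableSet_image_tupleRank K T)
  have hAVm : Measurable fun x => (A x, V x) := hA.prodMk hV
  set E : Set (α × (Fin m → α)) := {p | ((A p.1, V p.1), p.2) ∈ F} with hE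
  have hEm : MeasurableSet E := ((hAVm.comp measurable_fst).prodMk measurable_snd) hFm
  -- With `z` and the second label of point `j` frozen, all ranks, hence the target set `T`, are
  -- fixed. The label sum is then a translate of a uniform variable, so its probability of selecting
  -- `T` is `c`.
  have hslice : ∀ z : Fin m → α, Function.Injective (V ∘ z) →
      ρ.real {y | (y, z) ∈ E} = c := by
    intro z hz
    have hFz : MeasurableSet {q : UnitAddCircle × ℝ | (q, z) ∈ F} :=
      measurable_prodMk_right hFm
    have h1 : ρ {y | (y, z) ∈ E} = ((volume : Measure UnitAddCircle).prod κ) {q | (q, z) ∈ F} := by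
      rw [← hAV, Measure.map_apply hAVm hFz]
      rfl
    have h2 : ∀ᵐ v ∂κ, v ∉ Set.range (V ∘ z) :=
      measure_eq_zero_iff_ae_notMem.1 ((Set.finite_range _).measure_zero κ)
    have hc0 : ∀ᵐ v ∂κ, (volume : Measure UnitAddCircle)
        ((fun a => (a, v)) ⁻¹' {q | (q, z) ∈ F}) = ENNReal.ofReal c := by
      filter_upwards [h2] with v hv
      have hinj : Function.Injective (j.insertNth v (V ∘ z) : Fin (m + 1) → ℝ) :=
        injective_insertNth j hz hv
      set T := K.image (tupleRank (j.insertNth v (V ∘ z) : Fin (m + 1) → ℝ)) with hT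
      have hT1 : T ⊆ Finset.range (m + 1) := by
        rw [← image_tupleRank_univ hinj]
        exact Finset.image_subset_image (Finset.subset_univ K)
      have hT2 : T.card = K.card := Finset.card_image_of_injective _ (tupleRank_injective hinj)
      have h3 : (fun a : UnitAddCircle => (a, v)) ⁻¹' {q | (q, z) ∈ F} =
          (fun a => a + ∑ i, A (z i)) ⁻¹' {s | S s = T} := rfl
      rw [h3, measure_preimage_add_right, ← hc T hT1 hT2, ofReal_measureReal]
    have hcnn : 0 ≤ c := by
      obtain ⟨T, hT⟩ := Finset.exists_subset_card_eq
        (s := Finset.range (m + 1)) (n := K.card) (by simpa using K.card_le_univ)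
      rw [← hc T hT.1 hT.2]
      exact measureReal_nonneg
    rw [measureReal_def, h1, Measure.prod_apply_symm hFz, lintegral_congr_ae hc0]
    simp [hcnn]
  have hcomp := (measurePreserving_piFinSuccAbove (fun _ : Fin (m + 1) => ρ) j).integral_comp'
    (E.indicator fun p => H p.2)
  have hint : Integrable (E.indicator fun p : α × (Fin m → α) => H p.2)
      (ρ.prod (Measure.pi fun _ => ρ)) := (hH.comp_snd ρ).indicator hEm
  calc _ = ∫ x, (E.indicator fun p => H p.2)
        (MeasurableEquiv.piFinSuccAbove (fun _ => α) j x) ∂Measure.pi (fun _ => ρ) := by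
        refine integral_congr_ae (.of_forall fun x => ?_)
        have hins : (j.insertNth (V (x j)) (V ∘ j.removeNth x) : Fin (m + 1) → ℝ) = V ∘ x := by
          rw [Fin.insertNth_eq_iff]
          exact ⟨rfl, rfl⟩
        have hmem : MeasurableEquiv.piFinSuccAbove (fun _ => α) j x ∈ E ↔
            S (∑ i, A (x i)) = K.image (tupleRank (V ∘ x)) := by
          rw [Fin.sum_univ_succAbove _ j, ← hins]
          rfl
        beta_reduce
        by_cases hx : S (∑ i, A (x i)) = K.image (tupleRank (V ∘ x))
        · rw [Set.indicator_of_mem (by exact hx), Set.indicator_of_mem (hmem.2 hx)]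
          rfl
        · rw [Set.indicator_of_notMem (by exact hx), Set.indicator_of_notMem (mt hmem.1 hx)]
    _ = ∫ p, (E.indicator fun p => H p.2) p ∂(ρ.prod (Measure.pi fun _ => ρ)) := hcomp
    _ = ∫ z, ∫ y, (E.indicator fun p => H p.2) (y, z) ∂ρ ∂Measure.pi (fun _ => ρ) :=
        integral_prod_symm _ hint
    _ = ∫ z, c * H z ∂Measure.pi (fun _ => ρ) := by
        refine integral_congr_ae ?_
        have hV0 : ∀ b, ρ {x | V x = b} = 0 := by
          intro b
          have : {x | V x = b} = (fun x => (A x, V x)) ⁻¹' (Set.univ ×ˢ {b}) := by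
            ext x
            simp
          rw [this, ← Measure.map_apply hAVm (MeasurableSet.univ.prod (measurableSet_singleton b)),
            hAV, Measure.prod_prod]
          simp
        filter_upwards [ae_injective_comp_pi hV hV0 m] with z hz
        have : (fun y => (E.indicator fun p => H p.2) (y, z)) =
            {y | (y, z) ∈ E}.indicator fun _ => H z := rfl
        have hEz : MeasurableSet {y | (y, z) ∈ E} := measurable_prodMk_right hEm
        rw [this, integral_indicator_const _ hEz, hslice z hz, Complex.real_smul]
    _ = _ := integral_const_mul _ _

end AtomlessLabels

instance : IsProbabilityMeasure (volume : Measure UnitAddCircle) :=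
  ⟨UnitAddCircle.measure_univ⟩

instance : NullSingletonClass (volume : Measure UnitAddCircle) := by
  have : ConnectedSpace UnitAddCircle := inferInstance
  have : Nontrivial UnitAddCircle := ⟨⟨((1 / 2 : ℝ) : UnitAddCircle), 0, fun h => by
    rw [AddCircle.coe_eq_zero_iff_of_mem_Ico (by norm_num)] at h
    norm_num at h⟩⟩
  infer_instance

/-- A random subset of `{0, …, n - 1}`, uniform given its cardinality, defined on the circle. -/
lemma exists_random_subset (n : ℕ) {w : ℕ → ℝ} (hw : ∀ k, 0 ≤ w k)
    (hsum : ∑ k ∈ Finset.range (n + 1), w k = 1) :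
    ∃ S : UnitAddCircle → Finset ℕ, (∀ s, S s ⊆ Finset.range n) ∧
      (∀ t : Set (Finset ℕ), MeasurableSet (S ⁻¹' t)) ∧
      (∀ T ⊆ Finset.range n, volume.real {s | S s = T} = w T.card / n.choose T.card) ∧
      (w n = 1 → ∀ s, S s = Finset.range n) := by
  -- Treated apart so that the subset is full at every point of the circle, not merely almost
  -- everywhere.
  by_cases hn : w n = 1
  · refine ⟨fun _ => Finset.range n, fun _ => subset_rfl, fun t => .const (Finset.range n ∈ t),
      fun T hT => ?_, fun _ _ => rfl⟩
    rw [Finset.sum_range_succ, hn, add_eq_right] at hsum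
    have h0 := (Finset.sum_eq_zero_iff_of_nonneg fun k _ => hw k).1 hsum
    by_cases h : Finset.range n = T
    · simp [← h, hn, measureReal_def]
    · have hlt : T.card < n := by
        simpa using Finset.card_lt_card (hT.ssubset_of_ne (Ne.symm h))
      simp [h, h0 _ (Finset.mem_range.2 hlt)]
  let _ : MeasurableSpace (Finset ℕ) := ⊤
  have : DiscreteMeasurableSpace (Finset ℕ) := ⟨fun _ => trivial⟩
  set c : Finset ℕ → ℝ := fun T => w T.card / n.choose T.card with hc
  have hc0 : ∀ T, 0 ≤ c T := fun T => div_nonneg (hw _) (Nat.cast_nonneg _)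
  set κ : Measure (Finset ℕ) :=
    ∑ T ∈ (Finset.range n).powerset, ENNReal.ofReal (c T) • Measure.dirac T with hκ
  have hκa : ∀ t : Set (Finset ℕ), κ t =
      ∑ T ∈ (Finset.range n).powerset, ENNReal.ofReal (c T) * t.indicator 1 T := fun t => by
    simp [hκ, Measure.finsetSum_apply, Measure.dirac_apply' _ (MeasurableSet.of_discrete (s := t))]
  have hprob : IsProbabilityMeasure κ := ⟨by
    rw [hκa]
    simp only [Set.indicator_univ, Pi.one_apply, mul_one]
    rw [← ENNReal.ofReal_sum_of_nonneg fun T _ => hc0 T, hc,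
      Finset.sum_powerset_apply_card (fun k => w k / n.choose k), Finset.card_range]
    rw [Finset.sum_congr rfl (g := w), hsum, ENNReal.ofReal_one]
    intro k hk
    have : (n.choose k : ℝ) ≠ 0 := by
      exact_mod_cast (Nat.choose_pos (Nat.lt_succ_iff.1 (Finset.mem_range.1 hk))).ne'
    rw [nsmul_eq_mul, mul_div_cancel₀ _ this]⟩
  obtain ⟨g, hg, hgκ⟩ := exists_measurable_map_eq_of_noAtoms (volume : Measure UnitAddCircle) κ
  -- `g` may leave `range n` on a null set; intersecting repairs this without changing the law.
  have hm : ∀ t : Set (Finset ℕ), MeasurableSet ((fun s => g s ∩ Finset.range n) ⁻¹' t) := fun t =>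
    hg (MeasurableSet.of_discrete (s := (· ∩ Finset.range n) ⁻¹' t))
  refine ⟨fun s => g s ∩ Finset.range n, fun s => Finset.inter_subset_right, hm,
    fun T hT => ?_, fun h => absurd h hn⟩
  have h1 : volume {s | g s ∩ Finset.range n = T} = κ {T' | T' ∩ Finset.range n = T} := by
    rw [← hgκ, Measure.map_apply hg .of_discrete]
    rfl
  rw [measureReal_def, h1, hκa, Finset.sum_eq_single T]
  · rw [Set.indicator_of_mem (by simpa using hT)]
    simpa [hc] using hc0 T
  · intro T' hT' hne
    rw [Set.indicator_of_notMem, mul_zero]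
    simpa [Finset.inter_eq_left.2 (Finset.mem_powerset.1 hT')] using hne
  · intro h
    exact absurd (Finset.mem_powerset.2 hT) h

/-! ### Characters of counts, and the law of the thinned configuration -/

section Character

variable {α : Type*} {q : ℕ}

/-- The character whose product over the points of a configuration is `exp (i ∑ j, t j N (B j))`. -/
noncomputable def countChar (B : Fin q → Set α) (t : Fin q → ℝ) (y : α) : ℂ :=
  Complex.exp ((∑ j, (B j).indicator 1 y * t j : ℝ) * Complex.I)

lemma norm_countChar (B : Fin q → Set α) (t : Fin q → ℝ) (y : α) : ‖countChar B t y‖ = 1 :=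
  Complex.norm_exp_ofReal_mul_I _

variable [MeasurableSpace α]

lemma measurable_countChar {B : Fin q → Set α} (hB : ∀ j, MeasurableSet (B j)) (t : Fin q → ℝ) :
    Measurable (countChar B t) := by
  have : Measurable fun y => (∑ j, (B j).indicator 1 y * t j : ℝ) :=
    Finset.measurable_fun_sum _ fun j _ => (measurable_one.indicator (hB j)).mul_const _
  exact Complex.measurable_exp.comp ((Complex.measurable_ofReal.comp this).mul_const _)

lemma integrable_countChar {B : Fin q → Set α} (hB : ∀ j, MeasurableSet (B j)) (t : Fin q → ℝ)
    (ρ : Measure α) [IsFiniteMeasure ρ] : Integrable (countChar B t) ρ :=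
  .of_bound (measurable_countChar hB t).aestronglyMeasurable 1
    (.of_forall fun y => (norm_countChar B t y).le)

lemma cexp_sum_dirac {B : Fin q → Set α} (hB : ∀ j, MeasurableSet (B j)) (t : Fin q → ℝ)
    {ι : Type*} (K : Finset ι) (x : ι → α) :
    Complex.exp ((∑ j, ((∑ i ∈ K, Measure.dirac (x i) : Measure α) (B j)).toReal * t j : ℝ) *
      Complex.I) = ∏ i ∈ K, countChar B t (x i) := by
  have h : ∑ j, ((∑ i ∈ K, Measure.dirac (x i) : Measure α) (B j)).toReal * t j =
      ∑ i ∈ K, ∑ j, (B j).indicator 1 (x i) * t j := by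
    rw [Finset.sum_comm]
    refine Finset.sum_congr rfl fun j _ => ?_
    rw [← Finset.sum_mul, Measure.finsetSum_apply, ENNReal.toReal_sum (by simp)]
    congr 1
    refine Finset.sum_congr rfl fun i _ => ?_
    rw [Measure.dirac_apply' _ (hB j)]
    by_cases h : x i ∈ B j <;> simp [h]
  simp_rw [countChar]
  rw [← Complex.exp_sum, ← Finset.sum_mul, ← Complex.ofReal_sum, h]

/-- By disjointness at most one indicator is nonzero at each point, so the exponential of the sum
becomes a sum. -/
lemma integral_countChar {B : Fin q → Set α} (hB : ∀ j, MeasurableSet (B j))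
    (hd : Pairwise fun i j => Disjoint (B i) (B j)) (t : Fin q → ℝ) (ρ : Measure α)
    [IsProbabilityMeasure ρ] :
    ∫ y, countChar B t y ∂ρ = 1 + ∑ j, ρ.real (B j) * (Complex.exp (t j * Complex.I) - 1) := by
  have h : ∀ y, countChar B t y =
      1 + ∑ j, (B j).indicator (fun _ => Complex.exp (t j * Complex.I) - 1) y := by
    intro y
    by_cases hy : ∃ j, y ∈ B j
    · obtain ⟨j, hj⟩ := hy
      have hne : ∀ i, i ≠ j → y ∉ B i := fun i hi hiy =>
        Set.disjoint_left.1 (hd hi) hiy hj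
      rw [countChar, Finset.sum_eq_single j (fun i _ hi => by simp [hne i hi]) (by simp),
        Finset.sum_eq_single j (fun i _ hi => by simp [hne i hi]) (by simp)]
      simp [hj]
    · push Not at hy
      simp [countChar, hy]
  simp_rw [h]
  rw [integral_add (integrable_const _) (integrable_finsetSum _ fun j _ =>
    (integrable_const _).indicator (hB j)), integral_finsetSum _ fun j _ =>
    (integrable_const _).indicator (hB j)]
  simp [integral_indicator_const, hB]

end Character

namespace SimplePointMeasure

variable {α : Type*} [MeasurableSpace α] {A : α → UnitAddCircle} {V : α → ℝ}
  {φ : ℕ → UnitAddCircle → Finset ℕ}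

lemma coe_thin_ofTuple (hA : Measurable A) (hV : Measurable V)
    (hφ : ∀ n k, MeasurableSet {s | k ∈ φ n s}) {n : ℕ} {x : Fin n → α}
    (hx : Function.Injective (V ∘ x)) :
    (thin hA hV hφ (ofTuple x)).1 = ∑ i ∈ Finset.univ.filter fun i =>
      tupleRank (V ∘ x) i ∈ φ n (∑ i, A (x i)), Measure.dirac (x i) := by
  classical
  have hν := coe_ofTuple hx.of_comp
  set ν := ofTuple x
  have hC := measurableSet_retained hA hV hφ ν
  have huniv : ν.1 Set.univ = n := by simp [hν, Measure.finsetSum_apply]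
  have hrank : ∀ i, ν.1 {y | V y < V (x i)} = tupleRank (V ∘ x) i := fun i => by
    have : MeasurableSet {y | V y < V (x i)} := measurableSet_lt hV measurable_const
    simp [hν, Measure.finsetSum_apply, Measure.dirac_apply' _ this, Set.indicator_apply, tupleRank]
  have hmem : ∀ i, x i ∈ retained A V φ ν ↔
      tupleRank (V ∘ x) i ∈ φ n (∑ i, A (x i)) := fun i => by
    rw [retained, Set.mem_ofPred_eq, labelSum_eq hA ν x hν, huniv, hrank]
    simp only [Nat.cast_inj]
    constructor
    · rintro ⟨_, _, rfl, h, rfl⟩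
      exact h
    · exact fun h => ⟨_, _, rfl, h, rfl⟩
  change ν.1.restrict (retained A V φ ν) = _
  ext B hB
  rw [Measure.restrict_apply hB, hν, Measure.finsetSum_apply, Measure.finsetSum_apply,
    Finset.sum_filter]
  refine Finset.sum_congr rfl fun i _ => ?_
  rw [Measure.dirac_apply' _ (hB.inter hC), Measure.dirac_apply' _ hB]
  by_cases h : tupleRank (V ∘ x) i ∈ φ n (∑ i, A (x i))
  · simp [Set.indicator_apply, (hmem i).2 h, h]
  · simp [mt (hmem i).1 h, h]

end SimplePointMeasure

namespace SimplePointMeasure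

variable {α : Type*} [MeasurableSpace α] {A : α → UnitAddCircle} {V : α → ℝ}
  {φ : ℕ → UnitAddCircle → Finset ℕ}

lemma prod_mem_succAbove {m : ℕ} {M : Type*} [CommMonoid M] {K : Finset (Fin (m + 1))}
    {j : Fin (m + 1)} (hj : j ∉ K) (g : Fin (m + 1) → M) :
    ∏ l : Fin m, (if j.succAbove l ∈ K then g (j.succAbove l) else 1) = ∏ i ∈ K, g i := by
  have h := Fin.prod_univ_succAbove (fun i => if i ∈ K then g i else 1) j
  rw [if_neg hj, one_mul] at h
  rw [← h, Finset.prod_ite_mem, Finset.univ_inter]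

/-- The joint character of the counts of the thinning of `n` independent points. -/
lemma integral_cexp_thin (hA : Measurable A) (hV : Measurable V)
    (hφ : ∀ n k, MeasurableSet {s | k ∈ φ n s}) {ρ : Measure α} [IsProbabilityMeasure ρ]
    {κ : Measure ℝ} [IsProbabilityMeasure κ] [NullSingletonClass κ]
    (hAV : ρ.map (fun x => (A x, V x)) = (volume : Measure UnitAddCircle).prod κ)
    {n : ℕ} {w : ℕ → ℝ} (hw : ∀ k, 0 ≤ w k) (hsum : ∑ k ∈ Finset.range (n + 1), w k = 1)
    (hwn : w n = 0 ∨ w n = 1) (hS0 : ∀ s, φ n s ⊆ Finset.range n)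
    (hS : ∀ T, MeasurableSet {s | φ n s = T})
    (hSw : ∀ T ⊆ Finset.range n, volume.real {s | φ n s = T} = w T.card / n.choose T.card)
    (hS1 : w n = 1 → ∀ s, φ n s = Finset.range n)
    {q : ℕ} {B : Fin q → Set α} (hB : ∀ j, MeasurableSet (B j)) (t : Fin q → ℝ) :
    ∫ x, Complex.exp ((∑ j, ((thin hA hV hφ (ofTuple x)).1 (B j)).toReal * t j : ℝ) * Complex.I)
      ∂Measure.pi (fun _ : Fin n => ρ) =
      ∑ k ∈ Finset.range (n + 1), w k * (∫ y, countChar B t y ∂ρ) ^ k := by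
  have hV0 : ∀ b, ρ {x | V x = b} = 0 := by
    intro b
    have : {x | V x = b} = (fun x => (A x, V x)) ⁻¹' (Set.univ ×ˢ {b}) := by
      ext x
      simp
    rw [this, ← Measure.map_apply (hA.prodMk hV)
      (MeasurableSet.univ.prod (measurableSet_singleton b)), hAV, Measure.prod_prod]
    simp
  have hinj := ae_injective_comp_pi hV hV0 n
  set h := countChar B t with hh
  set z := ∫ y, h y ∂ρ with hz
  rcases hwn with hwn | hwn
  · obtain _ | m := n
    · simp [hwn] at hsum
    set E : Finset (Fin (m + 1)) → Set (Fin (m + 1) → α) := fun K =>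
      {x | φ (m + 1) (∑ i, A (x i)) = K.image (tupleRank (V ∘ x))} with hE
    have hEm : ∀ K, MeasurableSet (E K) := fun K => by
      refine measurableSet_eq_of_countable (fun T => ?_) fun T => ?_
      · have : Measurable fun x : Fin (m + 1) → α => ∑ i, A (x i) :=
          Finset.measurable_fun_sum _ fun i _ => hA.comp (measurable_pi_apply i)
        exact this (hS T)
      · have : Measurable fun x : Fin (m + 1) → α => V ∘ x :=
          measurable_pi_lambda _ fun i => hV.comp (measurable_pi_apply i)
        exact this (measurableSet_image_tupleRank K T)
    have hprodm : ∀ K : Finset (Fin (m + 1)), Measurable fun x : Fin (m + 1) → α =>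
        ∏ i ∈ K, h (x i) := fun K => Finset.measurable_fun_prod _ fun i _ =>
      (measurable_countChar hB t).comp (measurable_pi_apply i)
    have hK : ∀ K : Finset (Fin (m + 1)),
        ∫ x, (E K).indicator (fun x => ∏ i ∈ K, h (x i)) x ∂Measure.pi (fun _ => ρ) =
          (w K.card / (m + 1).choose K.card : ℝ) * z ^ K.card := by
      intro K
      have hc : ∀ T ⊆ Finset.range (m + 1), T.card = K.card →
          volume.real {s | φ (m + 1) s = T} = w K.card / (m + 1).choose K.card :=
        fun T hT hTK => by rw [hSw T hT, hTK]
      -- Keeping everything leaves no spare index to carry the randomness; here `w n = 0` makes this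
      -- event null.
      by_cases hKu : K = Finset.univ
      · have h1 := integral_selection hA hV hAV 0 K (H := fun _ => 1) (integrable_const _) hS hc
        have hcard : K.card = m + 1 := by simp [hKu]
        rw [hcard, hwn] at h1 ⊢
        have h2 : ∫ x, (E K).indicator (fun _ => (1 : ℂ)) x ∂Measure.pi (fun _ => ρ) = 0 := by
          simpa using h1
        rw [integral_indicator_const _ (hEm K), smul_eq_zero, or_iff_left one_ne_zero,
          measureReal_eq_zero_iff] at h2
        rw [integral_indicator (hEm K), Measure.restrict_eq_zero.2 h2]
        simp
      · obtain ⟨j, hj⟩ : ∃ j, j ∉ K := by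
          by_contra! hall
          exact hKu (Finset.eq_univ_iff_forall.2 hall)
        -- The deleted index `j` absorbs the randomness, and the product over `K` involves only the
        -- other points.
        set H : (Fin m → α) → ℂ := fun y =>
          ∏ l, (if j.succAbove l ∈ K then h else fun _ => 1) (y l) with hH
        have hHi : ∀ l, Integrable (if j.succAbove l ∈ K then h else fun _ => 1) ρ := fun l => by
          split_ifs
          · exact integrable_countChar hB t ρ
          · exact integrable_const _
        have h1 := integral_selection hA hV hAV j K (H := H) (Integrable.fintype_prod hHi) hS hc
        have h2 : ∫ y, H y ∂Measure.pi (fun _ => ρ) = z ^ K.card := by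
          rw [hH, integral_fintype_prod_eq_prod, ← Finset.prod_const,
            ← prod_mem_succAbove hj fun _ => z]
          refine Finset.prod_congr rfl fun l _ => ?_
          split_ifs <;> simp [hz]
        rw [← h2, ← h1]
        congr 1
        ext x
        congr 1
        ext x
        rw [hH, ← prod_mem_succAbove hj]
        refine Finset.prod_congr rfl fun l _ => ?_
        split_ifs <;> rfl
    calc _ = ∫ x, ∑ K ∈ Finset.univ.powerset, (E K).indicator (fun x => ∏ i ∈ K, h (x i)) x
          ∂Measure.pi (fun _ => ρ) := by
          refine integral_congr_ae ?_
          filter_upwards [hinj] with x hx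
          rw [coe_thin_ofTuple hA hV hφ hx, cexp_sum_dirac hB t]
          set K := Finset.univ.filter fun i =>
            tupleRank (V ∘ x) i ∈ φ (m + 1) (∑ i, A (x i)) with hKdef
          have hmem : ∀ K', x ∈ E K' ↔ K = K' := fun K' =>
            (filter_tupleRank_mem_eq_iff hx (hS0 _) K').symm
          rw [Finset.sum_eq_single K]
          · rw [Set.indicator_of_mem ((hmem K).2 rfl)]
          · intro K' _ hne
            rw [Set.indicator_of_notMem fun hK' => hne ((hmem K').1 hK').symm]
          · simp
      _ = ∑ K ∈ Finset.univ.powerset, ∫ x, (E K).indicator (fun x => ∏ i ∈ K, h (x i)) x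
          ∂Measure.pi (fun _ => ρ) := by
          refine integral_finsetSum _ fun K _ => Integrable.indicator ?_ (hEm K)
          refine .of_bound (hprodm K).aestronglyMeasurable 1 (.of_forall fun x => ?_)
          simp [norm_prod, hh, norm_countChar]
      _ = ∑ K ∈ (Finset.univ : Finset (Fin (m + 1))).powerset,
          (w K.card / (m + 1).choose K.card : ℝ) * z ^ K.card :=
          Finset.sum_congr rfl fun K _ => hK K
      _ = _ := by
          rw [Finset.sum_powerset_apply_card
            (fun k => ((w k / (m + 1).choose k : ℝ) : ℂ) * z ^ k), Finset.card_univ,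
            Fintype.card_fin]
          refine Finset.sum_congr rfl fun k hk => ?_
          have hne : ((m + 1).choose k : ℂ) ≠ 0 := by
            exact_mod_cast (Nat.choose_pos (Nat.lt_succ_iff.1 (Finset.mem_range.1 hk))).ne'
          rw [nsmul_eq_mul]
          push_cast
          field_simp
  · rw [Finset.sum_range_succ, hwn, add_eq_right] at hsum
    have h0 := (Finset.sum_eq_zero_iff_of_nonneg fun k _ => hw k).1 hsum
    rw [Finset.sum_range_succ, Finset.sum_eq_zero fun k hk => by simp [h0 k hk], hwn, zero_add,
      Complex.ofReal_one, one_mul]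
    have hpow := integral_fintype_prod_eq_pow (ι := Fin n) (μ := ρ) h
    rw [Fintype.card_fin] at hpow
    rw [← hpow]
    refine integral_congr_ae ?_
    filter_upwards [hinj] with x hx
    rw [coe_thin_ofTuple hA hV hφ hx, cexp_sum_dirac hB t]
    congr 1
    rw [hS1 hwn, filter_tupleRank_mem_eq_iff hx subset_rfl, image_tupleRank_univ hx]

end SimplePointMeasure

/-! ### Poisson mixtures and realization of a coupling -/

/-- The Poisson weights. -/
noncomputable def poissonWeight (r : ℝ) (n : ℕ) : ℝ := Real.exp (-r) * r ^ n / n.factorial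

lemma poissonWeight_nonneg {r : ℝ} (hr : 0 ≤ r) (n : ℕ) : 0 ≤ poissonWeight r n := by
  unfold poissonWeight
  positivity

lemma HasSum.of_forall_eq {ι M : Type*} [AddCommMonoid M] [TopologicalSpace M] {f g : ι → M} {a : M}
    (h : HasSum f a) (hfg : ∀ i, f i = g i) : HasSum g a :=
  funext hfg ▸ h

lemma hasSum_poissonWeight_mul_pow (r : ℝ) (z : ℂ) :
    HasSum (fun n => (poissonWeight r n : ℂ) * z ^ n) (Complex.exp (r * (z - 1))) := by
  have h := (NormedSpace.expSeries_div_hasSum_exp (r * z : ℂ)).mul_left (Complex.exp (-r))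
  rw [← Complex.exp_eq_exp_ℂ, ← Complex.exp_add] at h
  have hexp : Complex.exp (r * (z - 1)) = Complex.exp (-r + r * z) := by
    congr 1
    ring
  rw [hexp]
  refine HasSum.of_forall_eq h fun n => ?_
  simp only [poissonWeight]
  push_cast
  ring

lemma hasSum_poissonWeight (r : ℝ) : HasSum (poissonWeight r) 1 := by
  have h := hasSum_poissonWeight_mul_pow r 1
  simp only [one_pow, mul_one, sub_self, mul_zero, Complex.exp_zero] at h
  exact Complex.hasSum_ofReal.1 (by simpa using h)

/-- The double series is dominated by the joint weights of the coupling since `‖z‖ ≤ 1`. Summing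
over `n` first gives the generating function of the second marginal. -/
lemma hasSum_mixture {r s : ℝ} (hr : 0 ≤ r) {w : ℕ → ℕ → ℝ} (hw : ∀ n k, 0 ≤ w n k)
    (hrow : ∀ n, ∑ k ∈ Finset.range (n + 1), w n k = 1) (hzero : ∀ n k, n < k → w n k = 0)
    (hcol : ∀ k, HasSum (fun n => poissonWeight r n * w n k) (poissonWeight s k))
    {z : ℂ} (hz : ‖z‖ ≤ 1) {I : ℂ}
    (hI : HasSum (fun n => (poissonWeight r n : ℂ) *
      ∑ k ∈ Finset.range (n + 1), (w n k : ℂ) * z ^ k) I) :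
    I = Complex.exp (s * (z - 1)) := by
  have hrow' : ∀ n, HasSum (w n) 1 := fun n => by
    rw [← hrow n]
    exact hasSum_sum_of_ne_finset_zero fun k hk => hzero n k (by simpa using hk)
  have hsummable : Summable fun p : ℕ × ℕ => poissonWeight r p.1 * w p.1 p.2 := by
    rw [summable_prod_of_nonneg fun p => mul_nonneg (poissonWeight_nonneg hr _) (hw _ _)]
    refine ⟨fun n => (hrow' n).summable.mul_left (poissonWeight r n), ?_⟩
    have : (fun n => ∑' k, poissonWeight r n * w n k) = poissonWeight r := by
      ext n
      rw [tsum_mul_left, (hrow' n).tsum_eq, mul_one]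
    simpa only [this] using (hasSum_poissonWeight r).summable
  have hs : Summable fun p : ℕ × ℕ => (poissonWeight r p.1 : ℂ) * w p.1 p.2 * z ^ p.2 := by
    refine Summable.of_norm_bounded hsummable fun p => ?_
    rw [norm_mul, norm_mul, norm_pow, Complex.norm_of_nonneg (poissonWeight_nonneg hr _),
      Complex.norm_of_nonneg (hw _ _)]
    exact mul_le_of_le_one_right (mul_nonneg (poissonWeight_nonneg hr _) (hw _ _))
      (pow_le_one₀ (norm_nonneg _) hz)
  have h1 : ∀ n, ∑' k, (poissonWeight r n : ℂ) * w n k * z ^ k =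
      (poissonWeight r n : ℂ) * ∑ k ∈ Finset.range (n + 1), (w n k : ℂ) * z ^ k := fun n => by
    rw [tsum_eq_sum (s := Finset.range (n + 1)), Finset.mul_sum]
    · simp_rw [mul_assoc]
    · intro k hk
      rw [hzero n k (by simpa using hk)]
      simp
  have h2 : ∀ k, ∑' n, (poissonWeight r n : ℂ) * w n k * z ^ k = poissonWeight s k * z ^ k :=
    fun k => by
      have h := hcol k
      rw [← Complex.hasSum_ofReal] at h
      push_cast at h
      exact (h.mul_right _).tsum_eq
  rw [← hI.tsum_eq, ← (hasSum_poissonWeight_mul_pow s z).tsum_eq, ← tsum_congr h1,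
    ← tsum_congr h2]
  exact (Summable.tsum_comm
    (f := fun n k => (poissonWeight r n : ℂ) * w n k * z ^ k) hs).symm

namespace SimplePointMeasure

variable {α : Type*} [MeasurableSpace α]

/-- The law of the Poisson process of mean measure `r • ρ`, for a probability measure `ρ`. -/
noncomputable def poissonLaw (ρ : Measure α) (r : ℝ≥0) : Measure (SimplePointMeasure α) :=
  Measure.sum fun n => ENNReal.ofReal (poissonWeight r n) •
    (Measure.pi fun _ : Fin n => ρ).map ofTuple

variable {ρ : Measure α} [IsProbabilityMeasure ρ]

lemma measurable_cexp_counts {Ω : Type*} [MeasurableSpace Ω] {N : Ω → SimplePointMeasure α}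
    (hN : Measurable N) {q : ℕ} {B : Fin q → Set α} (hB : ∀ j, MeasurableSet (B j))
    (t : Fin q → ℝ) : Measurable fun ω =>
      Complex.exp ((∑ j, ((N ω).1 (B j)).toReal * t j : ℝ) * Complex.I) := by
  have : Measurable fun ω => (∑ j, ((N ω).1 (B j)).toReal * t j : ℝ) :=
    Finset.measurable_fun_sum _ fun j _ =>
      ((measurable_apply (hB j)).comp hN).ennreal_toReal.mul_const _
  exact Complex.measurable_exp.comp ((Complex.measurable_ofReal.comp this).mul_const _)

lemma prod_cexp_eq (c : ℝ≥0) {q : ℕ} {B : Fin q → Set α} (hB : ∀ j, MeasurableSet (B j))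
    (hd : Pairwise fun i j => Disjoint (B i) (B j)) (t : Fin q → ℝ) :
    ∏ j, Complex.exp (((c • ρ) (B j)).toReal * (Complex.exp (t j * Complex.I) - 1)) =
      Complex.exp (c * (∫ y, countChar B t y ∂ρ - 1)) := by
  rw [integral_countChar hB hd, ← Complex.exp_sum, add_sub_cancel_left, Finset.mul_sum]
  congr 1
  refine Finset.sum_congr rfl fun j _ => ?_
  rw [Measure.smul_apply]
  simp [measureReal_def, mul_assoc]

lemma norm_integral_countChar_le {q : ℕ} (B : Fin q → Set α) (t : Fin q → ℝ) :
    ‖∫ y, countChar B t y ∂ρ‖ ≤ 1 := by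
  simpa using norm_integral_le_of_norm_le_const (μ := ρ)
    (.of_forall fun y => (norm_countChar B t y).le)

variable [MeasurableEq α]

instance (r : ℝ≥0) : IsProbabilityMeasure (poissonLaw ρ r) := by
  have h : ∀ n, IsProbabilityMeasure ((Measure.pi fun _ : Fin n => ρ).map ofTuple) := fun n =>
    Measure.isProbabilityMeasure_map measurable_ofTuple.aemeasurable
  refine ⟨?_⟩
  rw [poissonLaw, Measure.sum_apply _ MeasurableSet.univ]
  simp only [Measure.smul_apply, measure_univ, smul_eq_mul, mul_one]
  rw [← ENNReal.ofReal_tsum_of_nonneg (poissonWeight_nonneg r.coe_nonneg) (hasSum_poissonWeight _).summable,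
    (hasSum_poissonWeight _).tsum_eq, ENNReal.ofReal_one]

lemma hasSum_integral_poissonLaw (r : ℝ≥0) {F : SimplePointMeasure α → ℂ} (hF : Measurable F)
    {C : ℝ} (hC : ∀ ν, ‖F ν‖ ≤ C) :
    HasSum (fun n => (poissonWeight r n : ℂ) * ∫ x, F (ofTuple x) ∂Measure.pi fun _ : Fin n => ρ)
      (∫ ν, F ν ∂poissonLaw ρ r) := by
  have hi : Integrable F (poissonLaw ρ r) :=
    .of_bound hF.aestronglyMeasurable C (.of_forall hC)
  refine HasSum.of_forall_eq (hasSum_integral_measure hi) fun n => ?_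
  rw [integral_smul_measure, integral_map measurable_ofTuple.aemeasurable hF.aestronglyMeasurable,
    ENNReal.toReal_ofReal (poissonWeight_nonneg r.coe_nonneg n), Complex.real_smul]

theorem isPoissonProcess_poissonLaw [StandardBorelSpace α] [NullSingletonClass ρ] (r : ℝ≥0) :
    IsPoissonProcess (r • ρ) id (poissonLaw ρ r) := by
  refine .of_charFun measurable_id _ fun q B hB hd t => ?_
  rw [prod_cexp_eq r hB hd t]
  refine (hasSum_integral_poissonLaw r (measurable_cexp_counts measurable_id hB t)
    fun ν => (Complex.norm_exp_ofReal_mul_I _).le).unique ?_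
  refine HasSum.of_forall_eq (hasSum_poissonWeight_mul_pow r _) fun n => ?_
  congr 1
  have hpow := integral_fintype_prod_eq_pow (ι := Fin n) (μ := ρ) (countChar B t)
  rw [Fintype.card_fin] at hpow
  rw [← hpow, eq_comm]
  have he := measurableEmbedding_embeddingReal α
  have h0 : ∀ b, ρ {x | embeddingReal α x = b} = 0 := fun b =>
    (Set.subsingleton_singleton.preimage he.injective).measure_zero ρ
  refine integral_congr_ae ?_
  filter_upwards [ae_injective_comp_pi he.measurable h0 n] with x hx
  rw [← cexp_sum_dirac hB t]
  simp [coe_ofTuple hx.of_comp]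

/-- A coupling of two Poisson laws in which a positive number of points is lost, except from
configurations that are kept entirely for sure, is realized by a deterministic thinning. -/
theorem exists_thinning_of_coupling [StandardBorelSpace α] [NullSingletonClass ρ] {r s : ℝ≥0}
    {w : ℕ → ℕ → ℝ} (hw : ∀ n k, 0 ≤ w n k)
    (hrow : ∀ n, ∑ k ∈ Finset.range (n + 1), w n k = 1) (hzero : ∀ n k, n < k → w n k = 0)
    (hdiag : ∀ n, w n n = 0 ∨ w n n = 1)
    (hcol : ∀ k, HasSum (fun n => poissonWeight r n * w n k) (poissonWeight s k)) :
    ∃ f : SimplePointMeasure α → SimplePointMeasure α, Measurable f ∧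
      ∃ P : Measure (SimplePointMeasure α), IsProbabilityMeasure P ∧
        IsPoissonProcess (r • ρ) id P ∧ IsPoissonProcess (s • ρ) f P ∧
        ∀ᵐ ν ∂P, (f ν).points ⊆ ν.points := by
  choose φ hφs hφm hφw hφ1 using fun n => exists_random_subset n (hw n) (hrow n)
  set κ : Measure ℝ := volume.restrict (Set.Icc 0 1) with hκ
  have hκp : IsProbabilityMeasure κ := ⟨by simp [hκ]⟩
  -- The two independent uniform labels of a location.
  obtain ⟨g, hg, hgρ⟩ := exists_measurable_map_eq_of_noAtoms ρ
    ((volume : Measure UnitAddCircle).prod κ)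
  have hA : Measurable fun x => (g x).1 := measurable_fst.comp hg
  have hV : Measurable fun x => (g x).2 := measurable_snd.comp hg
  have hφ : ∀ n k, MeasurableSet {s | k ∈ φ n s} := fun n k => hφm n {T | k ∈ T}
  refine ⟨thin hA hV hφ, measurable_thin hA hV hφ, poissonLaw ρ r, inferInstance,
    isPoissonProcess_poissonLaw r, ?_, .of_forall fun ν => points_restrict_subset _ _ _⟩
  refine .of_charFun (measurable_thin hA hV hφ) _ fun q B hB hd t => ?_
  rw [prod_cexp_eq s hB hd t]
  refine hasSum_mixture r.2 hw hrow hzero hcol (norm_integral_countChar_le B t) ?_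
  refine HasSum.of_forall_eq (hasSum_integral_poissonLaw r
    (measurable_cexp_counts (measurable_thin hA hV hφ) hB t)
    fun ν => (Complex.norm_exp_ofReal_mul_I _).le) fun n => ?_
  rw [integral_cexp_thin hA hV hφ hgρ (hw n) (hrow n) (hdiag n) (hφs n) (fun T => hφm n {T})
    (hφw n) (hφ1 n) hB t]
  rfl

end SimplePointMeasure

/-! ### The coupling of the numbers of points -/

/-- The length of the intersection of `[a, b)` and `[c, d)`. -/
noncomputable def overlap (a b c d : ℝ) : ℝ := max 0 (min b d - max a c)

lemma overlap_nonneg (a b c d : ℝ) : 0 ≤ overlap a b c d := le_max_left _ _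

/-- An increment of the truncation to `[c, d]`, so overlaps with consecutive intervals telescope. -/
lemma overlap_eq {a b c d : ℝ} (hab : a ≤ b) (hcd : c ≤ d) :
    overlap a b c d = max c (min b d) - max c (min a d) := by
  rw [overlap]
  rcases le_total b d with h1 | h1 <;> rcases le_total a c with h2 | h2 <;>
    rcases le_total a d with h3 | h3 <;> rcases le_total b c with h4 | h4 <;>
    simp only [min_def, max_def] <;> split_ifs <;> linarith

lemma overlap_comm (a b c d : ℝ) : overlap a b c d = overlap c d a b := by
  rw [overlap, overlap, min_comm, max_comm a c]

open Filter Topology in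
/-- The interval `[c, d)` is covered by the consecutive intervals `[F n, F (n + 1))`. -/
lemma hasSum_overlap {F : ℕ → ℝ} (hF : Monotone F) {l : ℝ} (hl : Tendsto F atTop (𝓝 l))
    {c d : ℝ} (hcd : c ≤ d) (hc : F 0 ≤ c) (hd : d ≤ l) :
    HasSum (fun n => overlap (F n) (F (n + 1)) c d) (d - c) := by
  rw [hasSum_iff_tendsto_nat_of_nonneg fun n => overlap_nonneg _ _ _ _]
  simp_rw [overlap_eq (hF (Nat.le_succ _)) hcd]
  have h1 : ∀ N, ∑ n ∈ Finset.range N, (max c (min (F (n + 1)) d) - max c (min (F n) d)) =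
      max c (min (F N) d) - c := fun N => by
    rw [Finset.sum_range_sub fun n => max c (min (F n) d),
      min_eq_left (hc.trans hcd), max_eq_left hc]
  simp_rw [h1]
  have h2 : Tendsto (fun N => max c (min (F N) d) - c) atTop (𝓝 (max c (min l d) - c)) :=
    ((tendsto_const_nhds.max (hl.min tendsto_const_nhds))).sub_const c
  rwa [min_eq_right hd, max_eq_right hcd] at h2

lemma sum_range_overlap {H : ℕ → ℝ} (hH : Monotone H) {a b : ℝ} (hab : a ≤ b) (ha : H 0 ≤ a)
    {N : ℕ} (hb : b ≤ H N) :
    ∑ k ∈ Finset.range N, overlap a b (H k) (H (k + 1)) = b - a := by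
  simp_rw [overlap_comm a b, overlap_eq (hH (Nat.le_succ _)) hab]
  rw [Finset.sum_range_sub fun k => max a (min (H k) b), min_eq_right hb, max_eq_right hab,
    min_eq_left (ha.trans hab), max_eq_left ha]

open Filter Topology in
/-- A coupling of two laws on `ℕ`, given by its transition weights `w`, which is the identity at
`0` and `1` and strictly decreasing at larger numbers. -/
lemma exists_coupling {x y : ℕ → ℝ} (hx0 : ∀ n, 0 < x n) (hy0 : ∀ n, 0 ≤ y n) (hx : HasSum x 1)
    (hy : HasSum y 1) (h0 : x 0 ≤ y 0) (h1 : x 1 ≤ y 1)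
    (hdom : ∀ n, 2 ≤ n → ∑ j ∈ Finset.range (n + 1), x j ≤ ∑ j ∈ Finset.range n, y j) :
    ∃ w : ℕ → ℕ → ℝ, (∀ n k, 0 ≤ w n k) ∧ (∀ n, ∑ k ∈ Finset.range (n + 1), w n k = 1) ∧
      (∀ n k, n < k → w n k = 0) ∧ (∀ n, w n n = 0 ∨ w n n = 1) ∧
      ∀ k, HasSum (fun n => x n * w n k) (y k) := by
  set F : ℕ → ℝ := fun n => ∑ j ∈ Finset.range n, x j with hF
  set G : ℕ → ℝ := fun n => ∑ j ∈ Finset.range n, y j with hG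
  have hFs : ∀ n, F (n + 1) = F n + x n := fun n => Finset.sum_range_succ _ _
  have hGs : ∀ n, G (n + 1) = G n + y n := fun n => Finset.sum_range_succ _ _
  have hFm : Monotone F := monotone_nat_of_le_succ fun n => by
    rw [hFs]
    linarith [hx0 n]
  have hF0 : F 0 = 0 := by simp [hF]
  have hG0 : G 0 = 0 := by simp [hG]
  -- Once `x 0` and `x 1` are matched at `0` and `1`, the target masses left are `y 0 - x 0`, `y 1 -
  -- x 1` and `y k` for `k ≥ 2`. These are the lengths of the intervals `[H k, H (k + 1))`, which
  -- start at `F 2`; the rest of the coupling is monotone.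
  set H : ℕ → ℝ := fun k => if k = 0 then x 0 + x 1 else if k = 1 then x 1 + y 0 else G k with hH
  have hH0 : H 0 = x 0 + x 1 := rfl
  have hH1 : H 1 = x 1 + y 0 := rfl
  have hH2 : ∀ k, 2 ≤ k → H k = G k := fun k hk => by
    simp only [hH]
    rw [if_neg (by omega), if_neg (by omega)]
  have hF2 : F 2 = x 0 + x 1 := by rw [hFs, hFs, hF0, zero_add]
  have hG2 : G 2 = y 0 + y 1 := by rw [hGs, hGs, hG0, zero_add]
  have hHm : Monotone H := monotone_nat_of_le_succ fun k => by
    obtain _ | _ | k := k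
    · rw [zero_add, hH0, hH1]
      linarith
    · rw [zero_add, hH1, hH2 _ le_rfl, hG2]
      linarith
    · rw [hH2 _ (by omega), hH2 _ (by omega), hGs (k + 1 + 1)]
      linarith [hy0 (k + 1 + 1)]
  have hH_le : ∀ k, H k ≤ 1 := fun k => by
    refine (hHm (Nat.le_add_right k 2)).trans ?_
    rw [hH2 _ (by omega)]
    exact sum_le_hasSum _ (fun n _ => hy0 n) hy
  have hFlim : Tendsto (fun n => F (n + 2)) atTop (𝓝 1) :=
    (tendsto_add_atTop_iff_nat 2).2 hx.tendsto_sum_nat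
  -- The interval of `n` lies below `H n`, so it only meets intervals of indices `k < n`: the
  -- decrease is strict.
  have hFH : ∀ n, 2 ≤ n → F (n + 1) ≤ H n := fun n hn => by
    rw [hH2 n hn]
    exact hdom n hn
  have hvanish : ∀ n k, 2 ≤ n → n ≤ k → overlap (F n) (F (n + 1)) (H k) (H (k + 1)) = 0 := by
    intro n k hn hnk
    have h2 := (hFH n hn).trans (hHm hnk)
    refine max_eq_left ?_
    linarith [min_le_left (F (n + 1)) (H (k + 1)), le_max_right (F n) (H k)]
  refine ⟨fun n k => if n < 2 then (if n = k then 1 else 0) else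
    overlap (F n) (F (n + 1)) (H k) (H (k + 1)) / x n, ?_, ?_, ?_, ?_, ?_⟩
  · intro n k
    beta_reduce
    split_ifs
    · exact zero_le_one
    · exact le_rfl
    · exact div_nonneg (overlap_nonneg _ _ _ _) (hx0 n).le
  · intro n
    by_cases hn : n < 2
    · simp [hn]
    · simp only [hn, if_false]
      push Not at hn
      rw [Finset.sum_range_succ, hvanish n n hn le_rfl, zero_div, add_zero, ← Finset.sum_div,
        sum_range_overlap hHm (hFm (Nat.le_succ n)) (by rw [hH0, ← hF2]; exact hFm hn) (hFH n hn),
        hFs, add_sub_cancel_left, div_self (hx0 n).ne']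
  · intro n k hnk
    beta_reduce
    split_ifs with hn hk
    · omega
    · rfl
    · rw [hvanish n k (by omega) hnk.le, zero_div]
  · intro n
    by_cases hn : n < 2
    · simp [hn]
    · left
      simp only [hn, if_false]
      rw [hvanish n n (by omega) le_rfl, zero_div]
  · intro k
    have hcol := hasSum_overlap (F := fun n => F (n + 2)) (fun a b hab => hFm (by omega)) hFlim
      (hHm (Nat.le_succ k)) (by
        change F 2 ≤ H k
        rw [hF2, ← hH0]
        exact hHm (Nat.zero_le k)) (hH_le (k + 1))
    have hcol' : HasSum (fun n => x (n + 2) * (if n + 2 < 2 then (if n + 2 = k then 1 else 0) else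
        overlap (F (n + 2)) (F (n + 2 + 1)) (H k) (H (k + 1)) / x (n + 2))) (H (k + 1) - H k) := by
      refine HasSum.of_forall_eq hcol fun n => ?_
      rw [if_neg (by omega), mul_div_cancel₀ _ (hx0 _).ne']
    rw [hasSum_nat_add_iff (f := fun n => x n * (if n < 2 then (if n = k then 1 else 0) else
        overlap (F n) (F (n + 1)) (H k) (H (k + 1)) / x n)) 2] at hcol'
    rw [Finset.sum_range_succ, Finset.sum_range_one] at hcol'
    refine Eq.subst (motive := fun b => HasSum _ b) ?_ hcol'
    obtain _ | _ | k := k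
    · rw [zero_add, hH0, hH1]
      simp
      ring
    · rw [zero_add, hH1, hH2 _ le_rfl, hG2]
      simp
      ring
    · rw [hH2 _ (by omega), hH2 _ (by omega), hGs (k + 1 + 1)]
      simp

/-! ### Numerical verification for 1.45, 0.7 and 0.6 -/

lemma exp_three_quarters_bounds : 2.1 < Real.exp 0.75 ∧ Real.exp 0.75 < 3 := by
  have h : Real.exp 0.75 ^ 4 = Real.exp 1 ^ 3 := by
    rw [← Real.exp_nat_mul, ← Real.exp_nat_mul]
    norm_num
  have h1 := Real.exp_one_gt_d9
  have h2 := Real.exp_one_lt_d9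
  constructor
  · refine lt_of_pow_lt_pow_left₀ 4 (Real.exp_pos _).le ?_
    rw [h]
    exact lt_trans (by norm_num) (pow_lt_pow_left₀ h1 (by norm_num) (by norm_num))
  · refine lt_of_pow_lt_pow_left₀ 4 (by norm_num) ?_
    rw [h]
    exact lt_trans (pow_lt_pow_left₀ h2 (Real.exp_pos _).le (by norm_num)) (by norm_num)

lemma exp_eighty_five_hundredths_lt : Real.exp 0.85 < 2.41 := by
  have h : Real.exp 0.85 ^ 20 = Real.exp 1 ^ 17 := by
    rw [← Real.exp_nat_mul, ← Real.exp_nat_mul]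
    norm_num
  refine lt_of_pow_lt_pow_left₀ 20 (by norm_num) ?_
  rw [h]
  exact lt_trans (pow_lt_pow_left₀ Real.exp_one_lt_d9 (Real.exp_pos _).le (by norm_num))
    (by norm_num)

lemma poissonWeight_seven_tenths_eq (k : ℕ) :
    poissonWeight 0.7 k = Real.exp (-1.45) * (Real.exp 0.75 * 0.7 ^ k / k.factorial) := by
  rw [poissonWeight, show (-0.7 : ℝ) = -1.45 + 0.75 by norm_num, Real.exp_add]
  ring

lemma poissonWeight_eq (r : ℝ) (k : ℕ) :
    poissonWeight r k = Real.exp (-r) * (r ^ k / k.factorial) := mul_div_assoc _ _ _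

lemma poissonWeight_seven_tenths_le {k : ℕ} (hk : 3 ≤ k) :
    poissonWeight 0.7 k ≤ poissonWeight 1.45 (k + 1) := by
  have h : Real.exp 0.75 * (k + 1) * 0.7 ^ k ≤ 1.45 ^ (k + 1) := by
    induction k, hk using Nat.le_induction with
    | base =>
      norm_num
      linarith [exp_three_quarters_bounds.2]
    -- From `k` to `k + 1` the left side is multiplied by `0.7 (k + 2) / (k + 1)`, which is at most
    -- `1.45`.
    | succ k hk ih =>
      have hk' : (3 : ℝ) ≤ k := by exact_mod_cast hk
      calc Real.exp 0.75 * ((k + 1 : ℕ) + 1) * 0.7 ^ (k + 1)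
          = (Real.exp 0.75 * 0.7 ^ k) * ((k + 2) * 0.7) := by push_cast; ring
        _ ≤ (Real.exp 0.75 * 0.7 ^ k) * ((k + 1) * 1.45) := by
          gcongr ?_ * ?_
          linarith
        _ = (Real.exp 0.75 * (k + 1) * 0.7 ^ k) * 1.45 := by ring
        _ ≤ 1.45 ^ (k + 1) * 1.45 := by gcongr
        _ = 1.45 ^ (k + 1 + 1) := (pow_succ _ _).symm
  rw [poissonWeight_seven_tenths_eq, poissonWeight_eq]
  refine mul_le_mul_of_nonneg_left ?_ (Real.exp_pos _).le
  rw [Nat.factorial_succ, div_le_div_iff₀ (by positivity) (by positivity)]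
  push_cast
  have := mul_le_mul_of_nonneg_right h (Nat.cast_nonneg (α := ℝ) k.factorial)
  linarith

/-- For `n ≥ 3` the complementary tails compare term by term. For `n = 2` they do not, since the
weight of `0.7` at `2` exceeds that of `1.45` at `3`; the partial sums are computed instead. -/
lemma sum_poissonWeight_le {n : ℕ} (hn : 2 ≤ n) :
    ∑ j ∈ Finset.range (n + 1), poissonWeight 1.45 j ≤ ∑ j ∈ Finset.range n, poissonWeight 0.7 j := by
  rcases hn.eq_or_lt with rfl | hn
  · simp only [Finset.sum_range_succ, Finset.sum_range_zero, poissonWeight_seven_tenths_eq,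
      poissonWeight_eq 1.45, ← mul_add, zero_add]
    refine mul_le_mul_of_nonneg_left ?_ (Real.exp_pos _).le
    norm_num [Nat.factorial]
    linarith [exp_three_quarters_bounds.1]
  · have hx := (hasSum_nat_add_iff' (n + 1)).2 (hasSum_poissonWeight 1.45)
    have hy := (hasSum_nat_add_iff' n).2 (hasSum_poissonWeight 0.7)
    have := hasSum_le (fun i => poissonWeight_seven_tenths_le (k := i + n) (by omega)) hy hx
    linarith

lemma exists_coupling_poissonWeight :
    ∃ w : ℕ → ℕ → ℝ, (∀ n k, 0 ≤ w n k) ∧ (∀ n, ∑ k ∈ Finset.range (n + 1), w n k = 1) ∧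
      (∀ n k, n < k → w n k = 0) ∧ (∀ n, w n n = 0 ∨ w n n = 1) ∧
      ∀ k, HasSum (fun n => poissonWeight 1.45 n * w n k) (poissonWeight 0.7 k) := by
  refine exists_coupling (fun n => ?_) (poissonWeight_nonneg (by norm_num))
    (hasSum_poissonWeight _) (hasSum_poissonWeight _) ?_ ?_ fun n hn => sum_poissonWeight_le hn
  · unfold poissonWeight
    positivity
  · rw [poissonWeight_seven_tenths_eq, poissonWeight_eq]
    refine mul_le_mul_of_nonneg_left ?_ (Real.exp_pos _).le
    norm_num
  · rw [poissonWeight_seven_tenths_eq, poissonWeight_eq]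
    refine mul_le_mul_of_nonneg_left ?_ (Real.exp_pos _).le
    norm_num
    linarith [exp_three_quarters_bounds.1]

/-- Only the mean measure matters: intensity `c / v` on a set of volume `v` is `c` times the
normalised measure. -/
theorem thinning_rescaled {E : Type*} [MeasureSpace E] [StandardBorelSpace E]
    [NullSingletonClass (volume : Measure E)] {S : Set E} (hS : MeasurableSet S) {v : ℝ≥0}
    (hv : volume S = v) (hv0 : v ≠ 0) :
    ThinningExists S (1.45 / v) (0.7 / v) ∧ ¬ ThinningExists S (1.45 / v) (0.6 / v) := by
  have := hS.standardBorel
  set m : Measure S := volume.comap (Subtype.val : S → E) with hm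
  have hma : ∀ B : Set S, m B = volume (Subtype.val '' B) := fun B =>
    (MeasurableEmbedding.subtype_coe hS).comap_apply _ _
  set ρ : Measure S := v⁻¹ • m with hρ
  have hprob : IsProbabilityMeasure ρ := ⟨by
    rw [hρ, Measure.smul_apply, hma, Set.image_univ, Subtype.range_coe, hv, ENNReal.smul_def,
      smul_eq_mul, ← ENNReal.coe_mul, inv_mul_cancel₀ hv0, ENNReal.coe_one]⟩
  have hnull : NullSingletonClass ρ := ⟨fun x => by
    rw [hρ, Measure.smul_apply, hma, Set.image_singleton, measure_singleton, smul_zero]⟩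
  have hscale : ∀ c : ℝ≥0, (c / v) • m = c • ρ := fun c => by
    rw [hρ, smul_smul, div_eq_mul_inv]
  simp only [ThinningExists, IsThinning, ← hm, hscale]
  constructor
  · obtain ⟨w, hw, hrow, hzero, hdiag, hcol⟩ := exists_coupling_poissonWeight
    exact SimplePointMeasure.exists_thinning_of_coupling hw hrow hzero hdiag
      (by push_cast; exact hcol)
  · rintro ⟨f, -, P, -, hr, hs, hsub⟩
    have hexp : Real.exp (-0.6) = Real.exp 0.85 * Real.exp (-1.45) := by
      rw [← Real.exp_add]
      norm_num
    refine not_isPoissonProcess_thinning ?_ ?_ hr hs hsub <;> push_cast <;> rw [hexp] <;>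
      nlinarith [exp_eighty_five_hundredths_lt, Real.exp_pos (-1.45)]

theorem mainTheorem5 :
    (∀ (d : ℕ) (S : Set (EuclideanSpace ℝ (Fin d))), 1 ≤ d → MeasurableSet S →
      0 < volume S → volume S < ∞ →
      ∃ r s s' : ℝ≥0, 0 < s' ∧ s' < s ∧ s < r ∧
        ThinningExists S r s ∧ ¬ ThinningExists S r s') ∧
    (∀ (d : ℕ) (S : Set (EuclideanSpace ℝ (Fin d))), 1 ≤ d → MeasurableSet S →
      volume S = 1 →
      ThinningExists S 1.45 0.7 ∧ ¬ ThinningExists S 1.45 0.6) ∧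
    (ThinningExists (Set.Icc (0 : ℝ) 1) 1.45 0.7 ∧
      ¬ ThinningExists (Set.Icc (0 : ℝ) 1) 1.45 0.6) := by
  have hnull : ∀ d : ℕ, 1 ≤ d →
      NullSingletonClass (volume : Measure (EuclideanSpace ℝ (Fin d))) := fun d hd => by
    have : Nonempty (Fin d) := ⟨⟨0, hd⟩⟩
    infer_instance
  refine ⟨fun d S hd hS h0 hlt => ?_, fun d S hd hS h1 => ?_, ?_⟩
  · have := hnull d hd
    lift volume S to ℝ≥0 using hlt.ne with v hv
    have hv0 : 0 < v := by exact_mod_cast h0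
    have h := thinning_rescaled hS hv.symm hv0.ne'
    refine ⟨1.45 / v, 0.7 / v, 0.6 / v, div_pos (by norm_num) hv0, ?_, ?_, h.1, h.2⟩
    · exact div_lt_div_of_pos_right (by norm_num) hv0
    · exact div_lt_div_of_pos_right (by norm_num) hv0
  · have := hnull d hd
    simpa using thinning_rescaled hS (v := 1) (by simpa using h1) one_ne_zero
  · simpa using thinning_rescaled (E := ℝ) (S := Set.Icc 0 1) measurableSet_Icc (v := 1)
      (by simp) one_ne_zero
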